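/- **Conventions.** A *doctrine* is a functor $P:\mathbb C^{\mathrm{op}}\to\mathbf{Pos}$ where $\mathbb C$ is a category with finite products (terminal object $\mathbf t$). It is *primary* if each $P(A)$ has finite meets and reindexing preserves them; *implicational* if moreover each $P(A)$ is cartesian closed (has implications $\to$) and reindexing preserves $\land,\top,\to$; *existential* if it is primary and, for all $A,B$, the map $P(\mathrm{pr}_1):P(A)\to P(A\times B)$ has a left adjoint $\exists^B_A$ satisfying Beck–Chevalley, $P(f)\exists^B_{A'}=\exists^B_AP(f\times\mathrm{id}_B)$ for $f:A\to A'$, and Frobenius reciprocity, $\exists^B_A(\alpha\land P(\mathrm{pr}_1)\beta)=\exists^B_A\alpha\land\beta$. An existential doctrine $R$ is *rich* if for every $A$ and $\sigma\in R(A)$ there is $d:\mathbf t\to A$ with $\exists^A_{\mathbf t}\sigma\le R(d)\sigma$. A *1-arrow* $(F,\mathfrak f):P\to R$ is a finite-product-preserving functor $F$ between the bases together with a natural transformation $\mathfrak f:P\to R\circ F^{\mathrm{op}}$ of poset-valued functors; it is *implicational existential* if $\mathfrak f$ preserves $\top,\land,\to$ and the $\exists^B_A$. A *2-cell* $(F,\mathfrak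 f)\Rightarrow(G,\mathfrak g)$ is a natural transformation $\theta:F\to G$ with $\mathfrak f_A(\alpha)\le R(\theta_A)\mathfrak g_A(\alpha)$ for all $A$ and $\alpha\in P(A)$. $\mathbf{Dct}_{\land,\top,\to,\exists}(P,R)$ is the category of implicational existential 1-arrows $P\to R$ and all 2-cells between them. **The doctrine $\underrightarrow P$.** Let $P:\mathbb C^{\mathrm{op}}\to\mathbf{Pos}$ be an implicational existential doctrine with small base, and let $\Lambda$ be the cardinality of $\bigsqcup_{X}P(X)$, regarded as an initial ordinal. *Constants.* Let $J$ be the set of finite lists $\bar X=((X_1,x_1),\dots,(X_n,x_n))$ of distinct elements of $\mathrm{ob}\,\mathbb C\times\Lambda$, preordered by inclusion of the sets of entries; write $\Pi\bar X=X_1\times\dots\times X_n$. The category $\underline{\mathbb C}$ has the objects of $\mathbb C$, and its arrows $A\to B$ are the elements $[f,\bar X]$ of the directed colimit over $J$ of the sets $\mathbb C(\Pi\bar X\times A,B)$ (transition maps: precomposition with projections), composed by $[g,\bar X]\circ[f,\bar X]=[g\langle\mathrm{pr}_1,f\rangle,\bar X]$. The doctrine $\underline P$ on $\underline{\mathbb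 C}$ has as $\underline P(A)$ the directed colimit over $J$ of the posets $P(\Pi\bar X\times A)$, with elements $[\alpha,\bar X]$, and $\underline P([f,\bar X])[\alpha,\bar X]=[P(\langle\mathrm{pr}_1,f\rangle)\alpha,\bar X]$. *Axioms.* For each object $B$ list (possibly with repetitions) the elements of $\underline P(B)$ as $[\varphi^B_j,\bar X^{(B,j)}]$, $j\in\Lambda$, with chosen representatives $\varphi^B_j\in P(\Pi\bar X^{(B,j)}\times B)$, in such a way that the labels $d^B_j$ which follow exist in $\Lambda$: $d^B_j$ is the least ordinal greater than every $d^B_h$, $h<j$, and greater than every second component of an entry of $\bar X^{(B,k)}$, $k\le j$. Let $\bar X^{(B,j)}_\star$ be $\bar X^{(B,j)}$ followed by the new entry $(B,d^B_j)$, and $$\psi^B_j:=P(\mathrm{pr}_1)\exists^{B}_{\Pi\bar X^{(B,j)}}\varphi^B_j\to\varphi^B_j\in P(\Pi\bar X^{(B,j)}\times B),$$ which defines an element $[\psi^B_j,\bar X_\star^{(B,j)}]$ of $\underline P(\mathbf t)$. For a finite set $\mathcal U$ of pairs $(B,j)$ put $\psi_{\mathcal U}=\bigwedge_{(B,j)\in\mathcal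 U}[\psi^B_j,\bar X_\star^{(B,j)}]$. The doctrine $\underrightarrow P:\underline{\mathbb C}^{\mathrm{op}}\to\mathbf{Pos}$ has as $\underrightarrow P(A)$ the directed colimit, over the finite sets $\mathcal U$ ordered by inclusion, of the posets $\{\alpha\in\underline P(A)\mid\alpha\le\underline P(!_A)\psi_{\mathcal U}\}$ with transition maps $\alpha\mapsto\alpha\land\underline P(!_A)\psi_{\mathcal V}$ for $\mathcal U\subseteq\mathcal V$; its elements are written $[\alpha,\mathcal U]$, and reindexing is that of $\underline P$. The doctrine $\underrightarrow P$ is implicational existential, and there is an implicational existential 1-arrow $(F,\mathfrak f):P\to\underrightarrow P$, where $F$ is the identity on objects, $F(f)=[f\circ\mathrm{pr}_2,\emptyset]$ and $\mathfrak f_A(\alpha)=[[P(\mathrm{pr}_2)\alpha,\emptyset],\emptyset]$ (here $\mathrm{pr}_2:\mathbf t\times A\to A$, and $\mathbf t$ is the empty product). **Proposition.** Let $P:\mathbb C^{\mathrm{op}}\to\mathbf{Pos}$ be an implicational existential doctrine with small base, and let $(F,\mathfrak f):P\to\underrightarrow P$ be the 1-arrow above, for any choice of the listings and representatives as above. Let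 $R$ be an implicational existential rich doctrine, and let $(H,\mathfrak h):P\to R$ and $(G,\mathfrak g):\underrightarrow P\to R$ be implicational existential 1-arrows with $(G,\mathfrak g)\circ(F,\mathfrak f)=(H,\mathfrak h)$. Then precomposition with $(F,\mathfrak f)$ induces an equivalence of coslice categories $$-\circ(F,\mathfrak f):\ (G,\mathfrak g)\downarrow\mathbf{Dct}_{\land,\top,\to,\exists}(\underrightarrow P,R)\ \longrightarrow\ (H,\mathfrak h)\downarrow\mathbf{Dct}_{\land,\top,\to,\exists}(P,R);$$ that is, this functor is an equivalence; in particular it is faithful, full and essentially surjective. -/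

import Mathlib

open CategoryTheory Limits Opposite

universe a b u v u' v' w

namespace HenkinDct

/-! ### Directed colimits of sets and of posets -/

/-- A diagram of sets indexed by a preorder. -/
structure DirFam (ι : Type a) [Preorder ι] where
  obj : ι → Type b
  map : ∀ {i j : ι}, i ≤ j → obj i → obj j
  map_self : ∀ {i : ι} (x : obj i), map (le_refl i) x = x
  map_map : ∀ {i j k : ι} (h : i ≤ j) (h' : j ≤ k) (x : obj i),
    map h' (map h x) = map (h.trans h') x

namespace DirFam

variable {ι : Type a} [Preorder ι] [IsDirectedOrder ι] (S T W : DirFam.{a, b} ι)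

/-- Two elements are identified when they become equal at a later stage. -/
def rel : Setoid (Σ i, S.obj i) where
  r x y := ∃ (k : ι) (hx : x.1 ≤ k) (hy : y.1 ≤ k), S.map hx x.2 = S.map hy y.2
  iseqv :=
    ⟨fun x => ⟨x.1, le_rfl, le_rfl, rfl⟩, fun ⟨k, hx, hy, e⟩ => ⟨k, hy, hx, e.symm⟩,
      fun {x y z} ⟨k, hx, hy, e⟩ ⟨l, hy', hz, e'⟩ => by
        obtain ⟨m, hk, hl⟩ := exists_ge_ge k l
        refine ⟨m, hx.trans hk, hz.trans hl, ?_⟩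
        rw [← S.map_map hx hk, e, S.map_map, ← S.map_map hz hl, ← e', S.map_map]⟩

/-- The directed colimit. -/
def Colim : Type (max a b) := Quotient S.rel

variable {S T W}

/-- The class of an element of the `i`-th stage. -/
def cls (i : ι) (x : S.obj i) : S.Colim := Quotient.mk S.rel ⟨i, x⟩

theorem cls_eq {i j : ι} {x : S.obj i} {y : S.obj j} :
    (cls i x : S.Colim) = cls j y ↔
      ∃ (k : ι) (hx : i ≤ k) (hy : j ≤ k), S.map hx x = S.map hy y :=
  ⟨fun h => Quotient.exact (s := S.rel) h, fun h => Quotient.sound (s := S.rel) h⟩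

theorem cls_map {i j : ι} (h : i ≤ j) (x : S.obj i) : (cls j (S.map h x) : S.Colim) = cls i x :=
  cls_eq.2 ⟨j, le_rfl, h, S.map_self _⟩

theorem exists_cls (z : S.Colim) : ∃ i x, z = cls i x := by
  rcases z with ⟨i, x⟩
  exact ⟨i, x, rfl⟩

theorem exists_cls₂ (z : S.Colim) (w : T.Colim) : ∃ i x y, z = cls i x ∧ w = cls i y := by
  obtain ⟨i, x, rfl⟩ := exists_cls z
  obtain ⟨j, y, rfl⟩ := exists_cls w
  obtain ⟨k, hi, hj⟩ := exists_ge_ge i j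
  exact ⟨k, S.map hi x, T.map hj y, (cls_map _ _).symm, (cls_map _ _).symm⟩

/-- A binary operation defined stage by stage: move both arguments to a common stage. -/
noncomputable def map₂ (g : ∀ i, S.obj i → T.obj i → W.obj i)
    (hg : ∀ {i j : ι} (h : i ≤ j) (x : S.obj i) (y : T.obj i),
      W.map h (g i x y) = g j (S.map h x) (T.map h y)) :
    S.Colim → T.Colim → W.Colim :=
  Quotient.lift₂ (s₁ := S.rel) (s₂ := T.rel)
    (fun x y =>
      have h := exists_ge_ge x.1 y.1
      cls h.choose (g _ (S.map h.choose_spec.1 x.2) (T.map h.choose_spec.2 y.2)))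
    (by
      have key : ∀ (x : Σ i, S.obj i) (y : Σ i, T.obj i) (k l : ι) (hx : x.1 ≤ k) (hy : y.1 ≤ k)
          (hx' : x.1 ≤ l) (hy' : y.1 ≤ l),
          (cls k (g k (S.map hx x.2) (T.map hy y.2)) : W.Colim) =
            cls l (g l (S.map hx' x.2) (T.map hy' y.2)) := by
        intro x y k l hx hy hx' hy'
        obtain ⟨m, hk, hl⟩ := exists_ge_ge k l
        rw [← cls_map hk, ← cls_map hl, hg, hg, S.map_map, S.map_map, T.map_map, T.map_map]
      rintro x y x' y' ⟨k, h₁, h₂, e⟩ ⟨l, h₃, h₄, e'⟩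
      obtain ⟨m, hk, hl⟩ := exists_ge_ge k l
      dsimp only
      rw [key x y _ m _ _ (h₁.trans hk) (h₃.trans hl), key x' y' _ m _ _ (h₂.trans hk) (h₄.trans hl),
        ← S.map_map h₁ hk, e, S.map_map, ← T.map_map h₃ hl, e', T.map_map])

theorem map₂_cls (g : ∀ i, S.obj i → T.obj i → W.obj i)
    (hg : ∀ {i j : ι} (h : i ≤ j) (x : S.obj i) (y : T.obj i),
      W.map h (g i x y) = g j (S.map h x) (T.map h y)) (i : ι) (x : S.obj i) (y : T.obj i) :
    map₂ g hg (cls i x) (cls i y) = cls i (g i x y) := by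
  have h := exists_ge_ge i i
  change cls h.choose (g _ (S.map h.choose_spec.1 x) (T.map h.choose_spec.2 y)) = _
  rw [← hg, cls_map]

variable [∀ i, PartialOrder (S.obj i)]

/-- The order of a directed colimit of posets: `z ≤ w` when this holds at some stage. -/
@[reducible] def partialOrder (hS : ∀ {i j : ι} (h : i ≤ j), Monotone (S.map h)) :
    PartialOrder S.Colim where
  le z w := ∃ i x y, z = cls i x ∧ w = cls i y ∧ x ≤ y
  le_refl z := by
    obtain ⟨i, x, rfl⟩ := exists_cls z
    exact ⟨i, x, x, rfl, rfl, le_rfl⟩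
  le_trans := by
    rintro _ _ _ ⟨i, x, y, rfl, rfl, h⟩ ⟨j, y', z, e, rfl, h'⟩
    obtain ⟨k, hi, hj, e⟩ := cls_eq.1 e
    exact ⟨k, S.map hi x, S.map hj z, (cls_map _ _).symm, (cls_map _ _).symm,
      (hS hi h).trans (e.le.trans (hS hj h'))⟩
  le_antisymm := by
    rintro _ _ ⟨i, x, y, rfl, rfl, h⟩ ⟨j, y', x', e, e', h'⟩
    obtain ⟨k, hi, hj, e⟩ := cls_eq.1 e
    obtain ⟨l, hi', hj', e'⟩ := cls_eq.1 e'
    obtain ⟨m, hk, hl⟩ := exists_ge_ge k l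
    refine cls_eq.2 ⟨m, hi.trans hk, hi.trans hk, le_antisymm (hS _ h) ?_⟩
    rw [← S.map_map hi hk, e, S.map_map, ← S.map_map hi' hl, e', S.map_map]
    exact hS _ h'

theorem cls_le_cls (hS : ∀ {i j : ι} (h : i ≤ j), Monotone (S.map h)) {i j : ι}
    {x : S.obj i} {y : S.obj j} :
    (partialOrder hS).le (cls i x) (cls j y) ↔
      ∃ (k : ι) (hi : i ≤ k) (hj : j ≤ k), S.map hi x ≤ S.map hj y := by
  constructor
  · rintro ⟨l, x', y', e, e', h⟩
    obtain ⟨k, hi, hj, e⟩ := cls_eq.1 e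
    obtain ⟨k', hi', hj', e'⟩ := cls_eq.1 e'
    obtain ⟨m, hk, hk'⟩ := exists_ge_ge k k'
    refine ⟨m, hi.trans hk, hi'.trans hk', ?_⟩
    rw [← S.map_map hi hk, e, ← S.map_map hi' hk', e', S.map_map, S.map_map]
    exact hS _ h
  · rintro ⟨k, hi, hj, h⟩
    exact ⟨k, _, _, (cls_map hi x).symm, (cls_map hj y).symm, h⟩

end DirFam

/-! ### Doctrines -/

section Doctrines

/-- `c` is the implication `a → b`: for all `x` one has `x ≤ c` iff `x ∧ a ≤ b`. -/
def IsImp {L : Type w} [PartialOrder L] (a b c : L) : Prop :=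
  ∀ x m : L, IsGLB {x, a} m → (x ≤ c ↔ m ≤ b)

/-- `e` is the value at `φ` of the left adjoint of the monotone map `p`,
that is, for all `γ` one has `e ≤ γ` iff `φ ≤ p γ`. -/
def IsEx {L M : Type w} [PartialOrder L] [PartialOrder M] (p : L →o M) (φ : M) (e : L) : Prop :=
  ∀ γ : L, e ≤ γ ↔ φ ≤ p γ

variable {C : Type u} [Category.{v} C]

/-- The fiber of a doctrine `P : Cᵒᵖ ⥤ PartOrd` over an object. -/
abbrev Fib (P : Cᵒᵖ ⥤ PartOrd.{w}) (A : C) : Type w := P.obj (op A)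

/-- Reindexing along an arrow. -/
def re (P : Cᵒᵖ ⥤ PartOrd.{w}) {A B : C} (f : A ⟶ B) : Fib P B →o Fib P A := (P.map f.op).hom

theorem re_id (P : Cᵒᵖ ⥤ PartOrd.{w}) {A : C} (x : Fib P A) : re P (𝟙 A) x = x := by
  simp [re]

theorem re_comp (P : Cᵒᵖ ⥤ PartOrd.{w}) {A B D : C} (f : A ⟶ B) (g : B ⟶ D) (x : Fib P D) :
    re P (f ≫ g) x = re P f (re P g x) := by
  simp [re]

/-- Primary doctrines: fibers have finite meets, and reindexing preserves them. -/
class Primary (P : Cᵒᵖ ⥤ PartOrd.{w}) : Prop where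
  exists_top : ∀ A : C, ∃ t : Fib P A, IsTop t
  exists_meet : ∀ (A : C) (x y : Fib P A), ∃ m, IsGLB {x, y} m
  re_top : ∀ {A B : C} (f : A ⟶ B) (t : Fib P B), IsTop t → IsTop (re P f t)
  re_meet : ∀ {A B : C} (f : A ⟶ B) (x y m : Fib P B),
    IsGLB {x, y} m → IsGLB {re P f x, re P f y} (re P f m)

/-- Implicational doctrines: fibers are cartesian closed, and reindexing preserves finite meets
and implications. -/
class Implicational (P : Cᵒᵖ ⥤ PartOrd.{w}) : Prop extends Primary P where
  exists_imp : ∀ (A : C) (x y : Fib P A), ∃ c, IsImp x y c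
  re_imp : ∀ {A B : C} (f : A ⟶ B) (x y c : Fib P B),
    IsImp x y c → IsImp (re P f x) (re P f y) (re P f c)

/-- Existential doctrines: primary doctrines in which reindexing along every product projection
`A ⨯ B ⟶ A` has a left adjoint, subject to the Beck-Chevalley condition and to Frobenius
reciprocity. -/
class Existential [HasFiniteProducts C] (P : Cᵒᵖ ⥤ PartOrd.{w}) : Prop extends Primary P where
  exists_ex : ∀ (A B : C) (φ : Fib P (A ⨯ B)), ∃ e, IsEx (re P (prod.fst : A ⨯ B ⟶ A)) φ e
  beckChevalley : ∀ {A A' : C} (B : C) (f : A ⟶ A') (φ : Fib P (A' ⨯ B)) (e : Fib P A'),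
    IsEx (re P (prod.fst : A' ⨯ B ⟶ A')) φ e →
      IsEx (re P (prod.fst : A ⨯ B ⟶ A)) (re P (prod.map f (𝟙 B)) φ) (re P f e)
  frobenius : ∀ (A B : C) (φ : Fib P (A ⨯ B)) (β e n : Fib P A) (m : Fib P (A ⨯ B)),
    IsEx (re P (prod.fst : A ⨯ B ⟶ A)) φ e →
      IsGLB {φ, re P (prod.fst : A ⨯ B ⟶ A) β} m → IsGLB {e, β} n →
        IsEx (re P (prod.fst : A ⨯ B ⟶ A)) m n

/-- Rich doctrines: for every `σ` over `A` there is a constant `d : ⊤_ ⟶ A` such that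
`∃ σ ≤ σ(d)`, where `∃ σ` is the value of the left adjoint to reindexing along `⊤_ ⨯ A ⟶ ⊤_` at
`σ`, seen as an element of the fiber over `⊤_ ⨯ A`. -/
def IsRich [HasFiniteProducts C] (P : Cᵒᵖ ⥤ PartOrd.{w}) : Prop :=
  ∀ (A : C) (σ : Fib P A), ∃ d : ⊤_ C ⟶ A, ∀ e : Fib P (⊤_ C),
    IsEx (re P (prod.fst : (⊤_ C) ⨯ A ⟶ ⊤_ C)) (re P (prod.snd : (⊤_ C) ⨯ A ⟶ A) σ) e →
      e ≤ re P d σ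

/-! ### The 2-category of doctrines -/

variable {D : Type u'} [Category.{v'} D]

/-- Doctrine morphisms (1-arrows). -/
structure DoctrineHom (P : Cᵒᵖ ⥤ PartOrd.{w}) (R : Dᵒᵖ ⥤ PartOrd.{w}) where
  functor : C ⥤ D
  preserves : PreservesFiniteProducts functor
  trans : P ⟶ functor.op ⋙ R

namespace DoctrineHom

variable {P : Cᵒᵖ ⥤ PartOrd.{w}} {R : Dᵒᵖ ⥤ PartOrd.{w}}

/-- The components of the natural transformation of a doctrine morphism. -/
def app (F : DoctrineHom P R) (A : C) : Fib P A →o Fib R (F.functor.obj A) :=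
  (F.trans.app (op A)).hom

theorem app_re (F : DoctrineHom P R) {A B : C} (f : A ⟶ B) (x : Fib P B) :
    F.app A (re P f x) = re R (F.functor.map f) (F.app B x) :=
  ConcreteCategory.congr_hom (F.trans.naturality f.op) x

/-- 2-cells between doctrine morphisms. -/
@[ext] structure TwoCell (F G : DoctrineHom P R) where
  nat : F.functor ⟶ G.functor
  le : ∀ (A : C) (α : Fib P A), F.app A α ≤ re R (nat.app A) (G.app A α)

instance : Category (DoctrineHom P R) where
  Hom F G := TwoCell F G
  id F := ⟨𝟙 _, fun A α => by simp [re_id]⟩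
  comp {F G H} θ η := ⟨θ.nat ≫ η.nat, fun A α => by
    rw [NatTrans.comp_app, re_comp]
    exact (θ.le A α).trans ((re R _).monotone (η.le A α))⟩
  id_comp θ := TwoCell.ext (Category.id_comp θ.nat)
  comp_id θ := TwoCell.ext (Category.comp_id θ.nat)
  assoc θ η ζ := TwoCell.ext (Category.assoc θ.nat η.nat ζ.nat)

/-- Composition of doctrine morphisms. -/
def comp {E : Type*} [Category* E] {S : Eᵒᵖ ⥤ PartOrd.{w}}
    (F : DoctrineHom P R) (G : DoctrineHom R S) : DoctrineHom P S where
  functor := F.functor ⋙ G.functor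
  preserves :=
    have := F.preserves
    have := G.preserves
    inferInstance
  trans := F.trans ≫ Functor.whiskerLeft F.functor.op G.trans

theorem comp_app {E : Type*} [Category* E] {S : Eᵒᵖ ⥤ PartOrd.{w}}
    (F : DoctrineHom P R) (G : DoctrineHom R S) (A : C) (x : Fib P A) :
    (F.comp G).app A x = G.app (F.functor.obj A) (F.app A x) := rfl

/-- Precomposition of 1-arrows and 2-cells with a doctrine morphism. -/
def precomp {E : Type*} [Category* E] (F : DoctrineHom P R) (S : Eᵒᵖ ⥤ PartOrd.{w}) :
    DoctrineHom R S ⥤ DoctrineHom P S where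
  obj G := F.comp G
  map θ := ⟨Functor.whiskerLeft F.functor (TwoCell.nat θ), fun A α => TwoCell.le θ (F.functor.obj A) (F.app A α)⟩
  map_id _ := TwoCell.ext (Functor.whiskerLeft_id' _)
  map_comp _ _ := TwoCell.ext (Functor.whiskerLeft_comp _ _ _)

variable [HasFiniteProducts C]

/-- The morphism preserves finite meets, implications and existential quantifiers.
As the functor preserves products, the image of the projection `A ⨯ B ⟶ A` is a
projection from a product of the images of `A` and `B`. -/
structure IsImpEx (F : DoctrineHom P R) : Prop where
  top : ∀ (A : C) (t : Fib P A), IsTop t → IsTop (F.app A t)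
  meet : ∀ (A : C) (x y m : Fib P A), IsGLB {x, y} m → IsGLB {F.app A x, F.app A y} (F.app A m)
  imp : ∀ (A : C) (x y c : Fib P A), IsImp x y c → IsImp (F.app A x) (F.app A y) (F.app A c)
  ex : ∀ (A B : C) (φ : Fib P (A ⨯ B)) (e : Fib P A), IsEx (re P (prod.fst : A ⨯ B ⟶ A)) φ e →
    IsEx (re R (F.functor.map (prod.fst : A ⨯ B ⟶ A))) (F.app (A ⨯ B) φ) (F.app A e)

end DoctrineHom

end Doctrines

/-! ### Elementary facts about meets, implications and left adjoints -/

section Posets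

variable {L M : Type w} [PartialOrder L] [PartialOrder M]

theorem isGLB_pair_iff {x y m : L} :
    IsGLB {x, y} m ↔ m ≤ x ∧ m ≤ y ∧ ∀ z, z ≤ x → z ≤ y → z ≤ m := by
  simp only [IsGLB, IsGreatest, lowerBounds, upperBounds, Set.mem_insert_iff,
    Set.mem_singleton_iff, forall_eq_or_imp, forall_eq, Set.mem_ofPred_eq, and_imp, and_assoc]

theorem IsEx.unique {p : L →o M} {φ : M} {e e' : L} (h : IsEx p φ e) (h' : IsEx p φ e') :
    e = e' :=
  le_antisymm ((h e').2 ((h' e').1 le_rfl)) ((h' e).2 ((h e).1 le_rfl))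

theorem isTop_unique {t t' : L} (h : IsTop t) (h' : IsTop t') : t = t' :=
  le_antisymm (h' t) (h t')

theorem IsImp.unique {x y c c' m m' : L} (h : IsImp x y c) (h' : IsImp x y c')
    (hm : IsGLB {c, x} m) (hm' : IsGLB {c', x} m') : c = c' :=
  le_antisymm ((h' c m hm).2 ((h c m hm).1 le_rfl)) ((h c' m' hm').2 ((h' c' m' hm').1 le_rfl))

end Posets

namespace DirFam

variable {ι : Type a} [Preorder ι] [IsDirectedOrder ι] {S : DirFam.{a, b} ι}
  [∀ i, PartialOrder (S.obj i)] (hS : ∀ {i j : ι} (h : i ≤ j), Monotone (S.map h))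

theorem cls_isTop {i : ι} {t : S.obj i} (h : ∀ (j : ι) (hj : i ≤ j), IsTop (S.map hj t)) :
    letI := partialOrder hS
    IsTop (cls i t : S.Colim) := by
  letI := partialOrder hS
  intro z
  obtain ⟨j, x, rfl⟩ := exists_cls z
  obtain ⟨k, hi, hj⟩ := exists_ge_ge i j
  exact (cls_le_cls hS).2 ⟨k, hj, hi, h k hi _⟩

theorem cls_isGLB {i : ι} {x y m : S.obj i}
    (h : ∀ (j : ι) (hj : i ≤ j), IsGLB {S.map hj x, S.map hj y} (S.map hj m)) :
    letI := partialOrder hS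
    IsGLB {(cls i x : S.Colim), cls i y} (cls i m) := by
  letI := partialOrder hS
  have h' := fun j hj => isGLB_pair_iff.1 (h j hj)
  refine isGLB_pair_iff.2 ⟨(cls_le_cls hS).2 ⟨i, le_rfl, le_rfl, (h' i le_rfl).1⟩,
    (cls_le_cls hS).2 ⟨i, le_rfl, le_rfl, (h' i le_rfl).2.1⟩, ?_⟩
  intro z hx hy
  obtain ⟨j, z, rfl⟩ := exists_cls z
  obtain ⟨k, hj, hi, hx⟩ := (cls_le_cls hS).1 hx
  obtain ⟨l, hj', hi', hy⟩ := (cls_le_cls hS).1 hy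
  obtain ⟨n, hk, hl⟩ := exists_ge_ge k l
  refine (cls_le_cls hS).2 ⟨n, hj.trans hk, hi.trans hk, (h' n _).2.2 _ ?_ ?_⟩
  · have := hS hk hx
    rwa [S.map_map, S.map_map] at this
  · have := hS hl hy
    rwa [S.map_map, S.map_map] at this

theorem cls_isImp {i : ι} {x y c : S.obj i}
    (hm : ∀ (j : ι) (u v : S.obj j), ∃ m, IsGLB {u, v} m)
    (hm' : ∀ {j k : ι} (h : j ≤ k) (u v m : S.obj j), IsGLB {u, v} m →
      IsGLB {S.map h u, S.map h v} (S.map h m))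
    (h : ∀ (j : ι) (hj : i ≤ j), IsImp (S.map hj x) (S.map hj y) (S.map hj c)) :
    letI := partialOrder hS
    IsImp (cls i x : S.Colim) (cls i y) (cls i c) := by
  letI := partialOrder hS
  intro z n hn
  obtain ⟨j, z, rfl⟩ := exists_cls z
  obtain ⟨k, hi, hj⟩ := exists_ge_ge i j
  obtain ⟨m, hm₀⟩ := hm k (S.map hj z) (S.map hi x)
  have e : n = cls k m := by
    refine hn.unique ?_
    have := cls_isGLB hS (fun l hl => hm' hl _ _ _ hm₀)
    rwa [cls_map, cls_map] at this
  subst e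
  rw [← cls_map hj, ← cls_map hi, ← cls_map hi y]
  rw [show ((cls k (S.map hj z) : S.Colim) ≤ cls k (S.map hi c)) ↔ _ from cls_le_cls hS,
    show ((cls k m : S.Colim) ≤ cls k (S.map hi y)) ↔ _ from cls_le_cls hS]
  refine exists_congr fun l => exists_congr fun hl => exists_congr fun hl' => ?_
  have := h l (hi.trans hl) (S.map hl (S.map hj z)) (S.map hl m)
  rw [← S.map_map hi hl, ← S.map_map hi hl, ← S.map_map hi hl] at this
  exact this (hm' _ _ _ _ hm₀)

end DirFam

/-! ### Existential doctrines and arbitrary product diagrams -/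

section Fans

variable {C : Type u} [Category.{v} C] {P : Cᵒᵖ ⥤ PartOrd.{w}}

theorem isImp_unique {A : C} [Primary P] {x y c c' : Fib P A} (h : IsImp x y c)
    (h' : IsImp x y c') : c = c' := by
  obtain ⟨m, hm⟩ := Primary.exists_meet A c x
  obtain ⟨m', hm'⟩ := Primary.exists_meet A c' x
  exact h.unique h' hm hm'

theorem isEx_iso {E E' A : C} (i : E' ≅ E) (p : E ⟶ A) {φ : Fib P E} {e : Fib P A} :
    IsEx (re P (i.hom ≫ p)) (re P i.hom φ) e ↔ IsEx (re P p) φ e := by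
  have : ∀ γ, re P i.hom φ ≤ re P (i.hom ≫ p) γ ↔ φ ≤ re P p γ := by
    intro γ
    rw [re_comp]
    refine ⟨fun h => ?_, fun h => (re P _).monotone h⟩
    have := (re P i.inv).monotone h
    rwa [← re_comp, ← re_comp, i.inv_hom_id, re_id, re_id] at this
  simp only [IsEx, this]

theorem isEx_iso' {E E' A : C} (i : E' ≅ E) {p : E ⟶ A} {p' : E' ⟶ A} (h : i.hom ≫ p = p')
    {φ : Fib P E} {e : Fib P A} :
    IsEx (re P p') (re P i.hom φ) e ↔ IsEx (re P p) φ e := by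
  subst h
  exact isEx_iso i p

theorem re_isGLB_iso [Primary P] {E E' : C} (i : E' ≅ E) {x y m : Fib P E} :
    IsGLB {re P i.hom x, re P i.hom y} (re P i.hom m) ↔ IsGLB {x, y} m := by
  refine ⟨fun h => ?_, Primary.re_meet _ _ _ _⟩
  have := Primary.re_meet i.inv _ _ _ h
  simpa only [← re_comp, i.inv_hom_id, re_id] using this

variable {A B E : C} {p : E ⟶ A} {q : E ⟶ B}

/-- Two product diagrams are isomorphic. -/
noncomputable def fanIso {E' : C} {p' : E' ⟶ A} {q' : E' ⟶ B}
    (h' : IsLimit (BinaryFan.mk p' q')) (h : IsLimit (BinaryFan.mk p q)) : E' ≅ E :=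
  h'.conePointUniqueUpToIso h

theorem fanIso_fst {E' : C} {p' : E' ⟶ A} {q' : E' ⟶ B}
    (h' : IsLimit (BinaryFan.mk p' q')) (h : IsLimit (BinaryFan.mk p q)) :
    (fanIso h' h).hom ≫ p = p' :=
  h'.conePointUniqueUpToIso_hom_comp h ⟨WalkingPair.left⟩

theorem fanIso_snd {E' : C} {p' : E' ⟶ A} {q' : E' ⟶ B}
    (h' : IsLimit (BinaryFan.mk p' q')) (h : IsLimit (BinaryFan.mk p q)) :
    (fanIso h' h).hom ≫ q = q' :=
  h'.conePointUniqueUpToIso_hom_comp h ⟨WalkingPair.right⟩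

theorem fan_hom_ext (h : IsLimit (BinaryFan.mk p q)) {Z : C} {f g : Z ⟶ E}
    (hp : f ≫ p = g ≫ p) (hq : f ≫ q = g ≫ q) : f = g :=
  BinaryFan.IsLimit.hom_ext h hp hq

variable [HasFiniteProducts C]

/-- The product diagram given by the chosen products. -/
noncomputable def prodFan (A B : C) :
    IsLimit (BinaryFan.mk (prod.fst : A ⨯ B ⟶ A) (prod.snd : A ⨯ B ⟶ B)) :=
  prodIsProd A B

theorem exists_ex_fan [Existential P] (h : IsLimit (BinaryFan.mk p q)) (φ : Fib P E) :
    ∃ e, IsEx (re P p) φ e := by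
  obtain ⟨e, he⟩ := Existential.exists_ex A B (re P (fanIso (prodFan A B) h).hom φ)
  rw [isEx_iso' _ (fanIso_fst _ _)] at he
  exact ⟨e, he⟩

theorem beckChevalley_fan [Existential P] (h : IsLimit (BinaryFan.mk p q))
    {A' E' : C} {p' : E' ⟶ A'} {q' : E' ⟶ B} (h' : IsLimit (BinaryFan.mk p' q'))
    (f : A' ⟶ A) (g : E' ⟶ E) (hp : g ≫ p = p' ≫ f) (hq : g ≫ q = q')
    {φ : Fib P E} {e : Fib P A} (he : IsEx (re P p) φ e) :
    IsEx (re P p') (re P g φ) (re P f e) := by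
  have he' := he
  rw [← isEx_iso' _ (fanIso_fst (prodFan A B) h)] at he'
  have := Existential.beckChevalley B f _ _ he'
  rw [← re_comp] at this
  have e : prod.map f (𝟙 B) ≫ (fanIso (prodFan A B) h).hom =
      (fanIso (prodFan A' B) h').hom ≫ g := by
    apply fan_hom_ext h
    · simp only [Category.assoc, fanIso_fst, prod.map_fst, hp]
      rw [← Category.assoc, fanIso_fst]
    · simp only [Category.assoc, fanIso_snd, prod.map_snd, hq, Category.comp_id]
  rwa [e, re_comp, isEx_iso' _ (fanIso_fst _ _)] at this

theorem frobenius_fan [Existential P] (h : IsLimit (BinaryFan.mk p q))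
    {φ m : Fib P E} {β e n : Fib P A} (he : IsEx (re P p) φ e)
    (hm : IsGLB {φ, re P p β} m) (hn : IsGLB {e, β} n) : IsEx (re P p) m n := by
  rw [← isEx_iso' _ (fanIso_fst (prodFan A B) h)] at he ⊢
  rw [← re_isGLB_iso (fanIso (prodFan A B) h), ← re_comp, fanIso_fst] at hm
  exact Existential.frobenius A B _ β e n _ he hm hn

/-- The existential structure can be checked on any choice of product diagrams. -/
theorem existential_of_fans [Primary P] (E : C → C → C) (p : ∀ A B, E A B ⟶ A)
    (q : ∀ A B, E A B ⟶ B) (h : ∀ A B, IsLimit (BinaryFan.mk (p A B) (q A B)))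
    (h₁ : ∀ (A B : C) (φ : Fib P (E A B)), ∃ e, IsEx (re P (p A B)) φ e)
    (h₂ : ∀ {A' A : C} (B : C) (f : A' ⟶ A) (g : E A' B ⟶ E A B), g ≫ p A B = p A' B ≫ f →
      g ≫ q A B = q A' B → ∀ (φ : Fib P (E A B)) (e : Fib P A), IsEx (re P (p A B)) φ e →
        IsEx (re P (p A' B)) (re P g φ) (re P f e))
    (h₃ : ∀ (A B : C) (φ m : Fib P (E A B)) (β e n : Fib P A), IsEx (re P (p A B)) φ e →
      IsGLB {φ, re P (p A B) β} m → IsGLB {e, β} n → IsEx (re P (p A B)) m n) :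
    Existential P := by
  have key : ∀ (A B : C) (φ : Fib P (A ⨯ B)) (e : Fib P A),
      IsEx (re P (prod.fst : A ⨯ B ⟶ A)) φ e ↔
        IsEx (re P (p A B)) (re P (fanIso (h A B) (prodFan A B)).hom φ) e := by
    intro A B φ e
    rw [isEx_iso' _ (fanIso_fst (h A B) (prodFan A B))]
  refine ⟨?_, ?_, ?_⟩
  · intro A B φ
    obtain ⟨e, he⟩ := h₁ A B (re P (fanIso (h A B) (prodFan A B)).hom φ)
    exact ⟨e, (key _ _ _ _).2 he⟩
  · intro A A' B f φ e he
    rw [key] at he ⊢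
    let g : E A B ⟶ E A' B := (fanIso (h A B) (prodFan A B)).hom ≫ prod.map f (𝟙 B) ≫
      (fanIso (h A' B) (prodFan A' B)).inv
    have i₁ : (fanIso (h A' B) (prodFan A' B)).inv ≫ p A' B = prod.fst := by
      rw [Iso.inv_comp_eq, fanIso_fst]
    have i₂ : (fanIso (h A' B) (prodFan A' B)).inv ≫ q A' B = prod.snd := by
      rw [Iso.inv_comp_eq, fanIso_snd]
    have := h₂ B f g
      (by simp only [g, Category.assoc, i₁, prod.map_fst]; rw [← Category.assoc, fanIso_fst])
      (by simp only [g, Category.assoc, i₂, prod.map_snd, Category.comp_id, fanIso_snd]) _ _ he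
    rw [← re_comp] at this ⊢
    simpa [g] using this
  · intro A B φ β e n m he hm hn
    rw [key] at he ⊢
    refine h₃ A B _ _ β e n he ?_ hn
    rwa [← re_isGLB_iso (fanIso (h A B) (prodFan A B)), ← re_comp, fanIso_fst] at hm

end Fans

attribute [local simp] prod.lift_fst prod.lift_snd prod.lift_fst_assoc prod.lift_snd_assoc

/-! ### Adding constants -/

/-- Finite lists with pairwise different entries of labelled objects `(X, x)`; the label `x`
ranges over `Λ`. -/
def ConstList (C : Type u) (Λ : Type u) : Type u := {l : List (C × Λ) // l.Nodup}

namespace ConstList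

variable {C : Type u} {Λ : Type u}

/-- Lists are ordered by inclusion of their sets of entries. -/
instance : Preorder (ConstList C Λ) where
  le X Y := X.1 ⊆ Y.1
  le_refl X := List.Subset.refl X.1
  le_trans _ _ _ h k := List.Subset.trans h k

/-- The empty list. -/
def nil : ConstList C Λ := ⟨[], List.nodup_nil⟩

theorem nil_le (X : ConstList C Λ) : nil ≤ X := List.nil_subset X.1

/-- Add an entry at the end of a list. -/
def snoc (X : ConstList C Λ) (p : C × Λ) (h : p ∉ X.1) : ConstList C Λ :=
  ⟨X.1 ++ [p], by simpa [List.nodup_append, X.2] using fun a b hab => by rintro rfl; exact h hab⟩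

theorem le_snoc (X : ConstList C Λ) (p : C × Λ) (h : p ∉ X.1) : X ≤ X.snoc p h :=
  List.subset_append_left _ _

theorem mem_snoc (X : ConstList C Λ) (p : C × Λ) (h : p ∉ X.1) : p ∈ (X.snoc p h).1 :=
  List.mem_append_right _ (List.mem_singleton.2 rfl)

instance : IsDirectedOrder (ConstList C Λ) where
  directed X Y := by
    classical
    exact ⟨⟨X.1 ∪ Y.1, Y.2.union X.1⟩, fun _ h => List.mem_union_iff.2 (Or.inl h),
      fun _ h => List.mem_union_iff.2 (Or.inr h)⟩

variable [Category.{v} C] [HasFiniteProducts C]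

instance (X : ConstList C Λ) : Finite {p // p ∈ X.1} := X.1.finite_toSet.to_subtype

/-- The product of the objects in a list. -/
noncomputable def prod (X : ConstList C Λ) : C := ∏ᶜ fun p : {p // p ∈ X.1} => p.1.1

/-- The projection on an entry. -/
noncomputable def proj (X : ConstList C Λ) (p : C × Λ) (h : p ∈ X.1) : X.prod ⟶ p.1 :=
  Pi.π (fun p : {p // p ∈ X.1} => p.1.1) ⟨p, h⟩

/-- The projection on the product of a smaller list. -/
noncomputable def restr {X Y : ConstList C Λ} (h : X ≤ Y) : Y.prod ⟶ X.prod :=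
  Pi.lift fun p : {p // p ∈ X.1} => Y.proj p.1 (h p.2)

@[simp]
theorem restr_proj {X Y : ConstList C Λ} (h : X ≤ Y) (p : C × Λ) (hp : p ∈ X.1) :
    restr h ≫ X.proj p hp = Y.proj p (h hp) :=
  Pi.lift_π _ _

@[simp]
theorem restr_proj_assoc {X Y : ConstList C Λ} (h : X ≤ Y) (p : C × Λ) (hp : p ∈ X.1) {Z : C}
    (k : p.1 ⟶ Z) : restr h ≫ X.proj p hp ≫ k = Y.proj p (h hp) ≫ k := by
  rw [← Category.assoc, restr_proj]

theorem hom_ext {X : ConstList C Λ} {Z : C} {f g : Z ⟶ X.prod}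
    (h : ∀ p hp, f ≫ X.proj p hp = g ≫ X.proj p hp) : f = g :=
  Pi.hom_ext _ _ fun p => h p.1 p.2

@[simp]
theorem restr_self (X : ConstList C Λ) : restr (le_refl X) = 𝟙 X.prod :=
  hom_ext fun p hp => by simp

@[simp]
theorem restr_restr {X Y Z : ConstList C Λ} (h : X ≤ Y) (h' : Y ≤ Z) :
    restr h' ≫ restr h = restr (h.trans h') :=
  hom_ext fun p hp => by simp

@[simp]
theorem restr_restr_assoc {X Y Z : ConstList C Λ} (h : X ≤ Y) (h' : Y ≤ Z) {W : C}
    (k : X.prod ⟶ W) : restr h' ≫ restr h ≫ k = restr (h.trans h') ≫ k := by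
  rw [← Category.assoc, restr_restr]

/-- The transition arrow between two stages. -/
noncomputable def trans {X Y : ConstList C Λ} (h : X ≤ Y) (A : C) : Y.prod ⨯ A ⟶ X.prod ⨯ A :=
  prod.map (restr h) (𝟙 A)

@[simp]
theorem trans_fst {X Y : ConstList C Λ} (h : X ≤ Y) (A : C) :
    trans h A ≫ prod.fst = prod.fst ≫ restr h := prod.map_fst _ _

@[simp]
theorem trans_snd {X Y : ConstList C Λ} (h : X ≤ Y) (A : C) :
    trans h A ≫ prod.snd = prod.snd := by simp [trans]

@[simp]
theorem trans_self (X : ConstList C Λ) (A : C) : trans (le_refl X) A = 𝟙 (X.prod ⨯ A) := by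
  simp [trans]

@[simp]
theorem trans_trans {X Y Z : ConstList C Λ} (h : X ≤ Y) (h' : Y ≤ Z) (A : C) :
    trans h' A ≫ trans h A = trans (h.trans h') A := by
  simp [trans]

@[simp]
theorem trans_fst_assoc {X Y : ConstList C Λ} (h : X ≤ Y) (A : C) {W : C} (k : X.prod ⟶ W) :
    trans h A ≫ prod.fst ≫ k = prod.fst ≫ restr h ≫ k := by
  rw [← Category.assoc, trans_fst, Category.assoc]

@[simp]
theorem trans_snd_assoc {X Y : ConstList C Λ} (h : X ≤ Y) (A : C) {W : C} (k : A ⟶ W) :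
    trans h A ≫ prod.snd ≫ k = prod.snd ≫ k := by
  rw [← Category.assoc, trans_snd]

@[simp]
theorem trans_trans_assoc {X Y Z : ConstList C Λ} (h : X ≤ Y) (h' : Y ≤ Z) (A : C) {W : C}
    (k : X.prod ⨯ A ⟶ W) : trans h' A ≫ trans h A ≫ k = trans (h.trans h') A ≫ k := by
  rw [← Category.assoc, trans_trans]

end ConstList

/-- The base category of the doctrine with constants has the same objects as `C`. -/
structure AddConst (C : Type u) (Λ : Type u) : Type u where
  obj : C

namespace AddConst

open ConstList

variable {C : Type u} [SmallCategory C] [HasFiniteProducts C] (Λ : Type u)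

/-- At the stage `X` the arrows from `A` to `B` are the arrows `∏ X ⨯ A ⟶ B`. -/
@[reducible] noncomputable def homFam (A B : C) : DirFam.{u, u} (ConstList C Λ) where
  obj X := X.prod ⨯ A ⟶ B
  map h f := trans h A ≫ f
  map_self f := by simp
  map_map h h' f := by simp

variable {Λ}

/-- The class of an arrow at the stage `X`. -/
noncomputable def homCls {A B : C} (X : ConstList C Λ) (f : X.prod ⨯ A ⟶ B) :
    (homFam Λ A B).Colim :=
  DirFam.cls (S := homFam Λ A B) X f

theorem trans_comp {A B E : C} {X Y : ConstList C Λ} (h : X ≤ Y) (f : X.prod ⨯ A ⟶ B)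
    (g : X.prod ⨯ B ⟶ E) : trans h A ≫ prod.lift prod.fst f ≫ g =
      prod.lift prod.fst (trans h A ≫ f) ≫ trans h B ≫ g := by
  rw [← Category.assoc, ← Category.assoc]
  congr 1
  ext <;> simp

/-- Composition, computed at a common stage. -/
noncomputable def homComp {A B E : C} :
    (homFam Λ A B).Colim → (homFam Λ B E).Colim → (homFam Λ A E).Colim :=
  DirFam.map₂ (S := homFam Λ A B) (T := homFam Λ B E) (W := homFam Λ A E)
    (fun _ f g => prod.lift prod.fst f ≫ g) trans_comp

theorem homComp_homCls {A B E : C} (X : ConstList C Λ) (f : X.prod ⨯ A ⟶ B)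
    (g : X.prod ⨯ B ⟶ E) :
    homComp (homCls X f) (homCls X g) = homCls X (prod.lift prod.fst f ≫ g) :=
  DirFam.map₂_cls (S := homFam Λ A B) (T := homFam Λ B E) (W := homFam Λ A E) _
    trans_comp X f g

theorem homCls_trans {A B : C} {X Y : ConstList C Λ} (h : X ≤ Y) (f : X.prod ⨯ A ⟶ B) :
    homCls Y (trans h A ≫ f) = homCls X f :=
  DirFam.cls_map (S := homFam Λ A B) h f

theorem homCls_snd {A : C} (X : ConstList C Λ) :
    homCls X (prod.snd : X.prod ⨯ A ⟶ A) = homCls nil prod.snd := by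
  rw [← homCls_trans (nil_le X)]
  congr 1
  simp

theorem exists_homCls {A B : C} (f : (homFam Λ A B).Colim) :
    ∃ (X : ConstList C Λ) (f' : X.prod ⨯ A ⟶ B), f = homCls X f' :=
  DirFam.exists_cls f

theorem exists_homCls₂ {A B A' B' : C} (f : (homFam Λ A B).Colim) (g : (homFam Λ A' B').Colim) :
    ∃ (X : ConstList C Λ) (f' : X.prod ⨯ A ⟶ B) (g' : X.prod ⨯ A' ⟶ B'),
      f = homCls X f' ∧ g = homCls X g' :=
  DirFam.exists_cls₂ f g

theorem homComp_assoc {A B E K : C} (f : (homFam Λ A B).Colim) (g : (homFam Λ B E).Colim)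
    (k : (homFam Λ E K).Colim) : homComp (homComp f g) k = homComp f (homComp g k) := by
  obtain ⟨X, f, g, rfl, rfl⟩ := exists_homCls₂ f g
  obtain ⟨Y, k, rfl⟩ := exists_homCls k
  obtain ⟨Z, hX, hY⟩ := exists_ge_ge X Y
  rw [← homCls_trans hX f, ← homCls_trans hX g, ← homCls_trans hY k]
  generalize trans hX A ≫ f = f
  generalize trans hX B ≫ g = g
  generalize trans hY E ≫ k = k
  rw [homComp_homCls, homComp_homCls, homComp_homCls, homComp_homCls, ← Category.assoc]
  congr 2
  ext <;> simp

/-- Arrows are the elements of the directed colimit of the arrows at the various stages. -/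
noncomputable instance : Category.{u} (AddConst C Λ) where
  Hom A B := (homFam Λ A.obj B.obj).Colim
  id A := homCls nil prod.snd
  comp f g := homComp f g
  id_comp {A B} f := by
    obtain ⟨X, f, rfl⟩ := exists_homCls f
    rw [← homCls_snd X, homComp_homCls]
    simp
  comp_id {A B} f := by
    obtain ⟨X, f, rfl⟩ := exists_homCls f
    rw [← homCls_snd X, homComp_homCls]
    simp
  assoc f g k := homComp_assoc f g k

/-- The arrow of `AddConst C Λ` given by an arrow at the stage `X`. -/
noncomputable def homMk {A B : C} (X : ConstList C Λ) (f : X.prod ⨯ A ⟶ B) :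
    (⟨A⟩ : AddConst C Λ) ⟶ ⟨B⟩ :=
  homCls X f

theorem homMk_eq {A B : C} {X Y : ConstList C Λ} {f : X.prod ⨯ A ⟶ B} {g : Y.prod ⨯ A ⟶ B} :
    homMk X f = homMk Y g ↔ ∃ (Z : ConstList C Λ) (hX : X ≤ Z) (hY : Y ≤ Z),
      trans hX A ≫ f = trans hY A ≫ g :=
  DirFam.cls_eq (S := homFam Λ A B)

theorem homMk_trans {A B : C} {X Y : ConstList C Λ} (h : X ≤ Y) (f : X.prod ⨯ A ⟶ B) :
    homMk Y (trans h A ≫ f) = homMk X f :=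
  homCls_trans h f

theorem exists_homMk {A B : AddConst C Λ} (f : A ⟶ B) :
    ∃ (X : ConstList C Λ) (f' : X.prod ⨯ A.obj ⟶ B.obj), f = homMk X f' :=
  exists_homCls f

theorem exists_homMk₂ {A B A' B' : AddConst C Λ} (f : A ⟶ B) (g : A' ⟶ B') :
    ∃ (X : ConstList C Λ) (f' : X.prod ⨯ A.obj ⟶ B.obj) (g' : X.prod ⨯ A'.obj ⟶ B'.obj),
      f = homMk X f' ∧ g = homMk X g' :=
  exists_homCls₂ f g

theorem homMk_comp {A B E : C} (X : ConstList C Λ) (f : X.prod ⨯ A ⟶ B) (g : X.prod ⨯ B ⟶ E) :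
    homMk X f ≫ homMk X g = homMk X (prod.lift prod.fst f ≫ g) :=
  homComp_homCls X f g

theorem id_eq (A : AddConst C Λ) : 𝟙 A = homMk nil prod.snd := rfl

theorem id_eq' {A : C} (X : ConstList C Λ) : 𝟙 (⟨A⟩ : AddConst C Λ) = homMk X prod.snd :=
  (homCls_snd X).symm

variable (C Λ) in
/-- The functor from `C`, mapping `f` to the class of `f` at the empty list. -/
noncomputable def incl : C ⥤ AddConst C Λ where
  obj A := ⟨A⟩
  map f := homMk nil (prod.snd ≫ f)
  map_id A := by rw [id_eq, Category.comp_id]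
  map_comp f g := by
    rw [homMk_comp, prod.lift_snd_assoc, Category.assoc]

theorem incl_map {A B : C} (f : A ⟶ B) (X : ConstList C Λ) :
    (incl C Λ).map f = homMk X (prod.snd ≫ f) := by
  change homMk nil (prod.snd ≫ f) = _
  rw [← homMk_trans (nil_le X)]
  congr 1
  simp

/-- Terminal objects of `C` are terminal in `AddConst C Λ`. -/
noncomputable def isTerminal {T : C} (hT : IsTerminal T) : IsTerminal (⟨T⟩ : AddConst C Λ) :=
  IsTerminal.ofUniqueHom (fun _ => homMk nil (hT.from _)) fun A m => by
    obtain ⟨X, m, rfl⟩ := exists_homMk m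
    rw [← homMk_trans (nil_le X) (hT.from _)]
    congr 1
    exact hT.hom_ext _ _

/-- Product diagrams of `C` are product diagrams in `AddConst C Λ`. -/
noncomputable def isLimitFan {A B E : C} {p : E ⟶ A} {q : E ⟶ B}
    (h : IsLimit (BinaryFan.mk p q)) :
    IsLimit (BinaryFan.mk ((incl C Λ).map p) ((incl C Λ).map q)) := by
  have hl : ∀ {Z : C} (X : ConstList C Λ) (f : X.prod ⨯ Z ⟶ A) (g : X.prod ⨯ Z ⟶ B),
      ∃ k : X.prod ⨯ Z ⟶ E, k ≫ p = f ∧ k ≫ q = g := fun X f g =>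
    ⟨_, (BinaryFan.IsLimit.lift' h f g).2⟩
  have ex : ∀ s : BinaryFan ((incl C Λ).obj A) ((incl C Λ).obj B),
      ∃ k : s.pt ⟶ (incl C Λ).obj E,
        k ≫ (incl C Λ).map p = s.fst ∧ k ≫ (incl C Λ).map q = s.snd := by
    intro s
    obtain ⟨X, f, g, hf, hg⟩ := exists_homMk₂ s.fst s.snd
    obtain ⟨k, hp, hq⟩ := hl X f g
    refine ⟨homMk X k, ?_, ?_⟩
    · rw [incl_map p X]
      refine (homMk_comp X k _).trans (Eq.trans ?_ hf.symm)
      rw [prod.lift_snd_assoc, hp]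
      rfl
    · rw [incl_map q X]
      refine (homMk_comp X k _).trans (Eq.trans ?_ hg.symm)
      rw [prod.lift_snd_assoc, hq]
      rfl
  have un : ∀ {Z : AddConst C Λ} (k l : Z ⟶ (incl C Λ).obj E),
      k ≫ (incl C Λ).map p = l ≫ (incl C Λ).map p →
        k ≫ (incl C Λ).map q = l ≫ (incl C Λ).map q → k = l := by
    intro Z k l hp hq
    obtain ⟨X, k, l, rfl, rfl⟩ := exists_homMk₂ k l
    change X.prod ⨯ Z.obj ⟶ E at k l
    have hc : ∀ {B' : C} (r : E ⟶ B') (k : X.prod ⨯ Z.obj ⟶ E),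
        homMk X k ≫ (incl C Λ).map r = homMk X (k ≫ r) := by
      intro B' r k
      rw [incl_map r X]
      refine (homMk_comp X k _).trans ?_
      rw [prod.lift_snd_assoc]
    have hp := homMk_eq.1 (((hc p k).symm.trans hp).trans (hc p l))
    have hq := homMk_eq.1 (((hc q k).symm.trans hq).trans (hc q l))
    obtain ⟨Y, hY, hY', ep⟩ := hp
    obtain ⟨Z', hZ, hZ', eq⟩ := hq
    obtain ⟨W, h₁, h₂⟩ := exists_ge_ge Y Z'
    refine homMk_eq.2 ⟨W, hY.trans h₁, hY.trans h₁, fan_hom_ext h ?_ ?_⟩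
    · have := congrArg (fun t => ConstList.trans h₁ _ ≫ t) ep
      rw [trans_trans_assoc, trans_trans_assoc] at this
      exact (Category.assoc _ _ _).trans (this.trans (Category.assoc _ _ _).symm)
    · have := congrArg (fun t => ConstList.trans h₂ _ ≫ t) eq
      rw [trans_trans_assoc, trans_trans_assoc] at this
      exact (Category.assoc _ _ _).trans (this.trans (Category.assoc _ _ _).symm)
  exact BinaryFan.isLimitMk (fun s => (ex s).choose) (fun s => (ex s).choose_spec.1)
    (fun s => (ex s).choose_spec.2)
    (fun s m h₁ h₂ => un _ _ (h₁.trans (ex s).choose_spec.1.symm)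
      (h₂.trans (ex s).choose_spec.2.symm))

instance : HasFiniteProducts (AddConst C Λ) := by
  have : HasTerminal (AddConst C Λ) := (isTerminal (Λ := Λ) (terminalIsTerminal (C := C))).hasTerminal
  have : HasBinaryProducts (AddConst C Λ) :=
    have : ∀ {A B : AddConst C Λ}, HasLimit (pair A B) := fun {A B} =>
      HasLimit.mk ⟨_, isLimitFan (Λ := Λ) (prodFan A.obj B.obj)⟩
    hasBinaryProducts_of_hasLimit_pair _
  exact hasFiniteProducts_of_has_binary_and_terminal

theorem incl_preserves : PreservesFiniteProducts (incl C Λ) := by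
  have h₁ : PreservesLimit (Functor.empty.{0} C) (incl C Λ) :=
    preservesLimit_of_preserves_limit_cone (terminalIsTerminal (C := C))
      ((isLimitMapConeEmptyConeEquiv _ _).symm (isTerminal terminalIsTerminal))
  have h₂ : PreservesLimitsOfShape (Discrete PEmpty.{1}) (incl C Λ) :=
    preservesLimitsOfShape_pempty_of_preservesTerminal _
  have h₃ : PreservesLimitsOfShape (Discrete WalkingPair) (incl C Λ) := ⟨fun {K} => by
    have : PreservesLimit (pair (K.obj ⟨.left⟩) (K.obj ⟨.right⟩)) (incl C Λ) :=
      preservesLimit_of_preserves_limit_cone (prodFan _ _)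
        ((isLimitMapConeBinaryFanEquiv _ _ _).symm (isLimitFan (prodFan _ _)))
    exact preservesLimit_of_iso_diagram _ (diagramIsoPair K).symm⟩
  exact .of_preserves_binary_and_terminal _

end AddConst

namespace AddConst

open ConstList

variable {C : Type u} [SmallCategory C] [HasFiniteProducts C] (P : Cᵒᵖ ⥤ PartOrd.{u}) (Λ : Type u)

/-- At the stage `X` the fiber over `A` is the fiber of `P` over `∏ X ⨯ A`. -/
@[reducible] noncomputable def fibFam (A : C) : DirFam.{u, u} (ConstList C Λ) where
  obj X := Fib P (X.prod ⨯ A)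
  map h := re P (trans h A)
  map_self φ := by rw [trans_self, re_id]
  map_map h h' φ := by rw [← re_comp, trans_trans]

theorem fibFam_mono (A : C) {X Y : ConstList C Λ} (h : X ≤ Y) :
    Monotone ((fibFam P Λ A).map h) := (re P (trans h A)).monotone

noncomputable instance (A : C) : PartialOrder (fibFam P Λ A).Colim :=
  DirFam.partialOrder (S := fibFam P Λ A) (fibFam_mono P Λ A)

variable {P Λ}

/-- The class of an element of the fiber at the stage `X`. -/
noncomputable def fibCls {A : C} (X : ConstList C Λ) (φ : Fib P (X.prod ⨯ A)) :
    (fibFam P Λ A).Colim :=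
  DirFam.cls (S := fibFam P Λ A) X φ

theorem fibCls_trans {A : C} {X Y : ConstList C Λ} (h : X ≤ Y) (φ : Fib P (X.prod ⨯ A)) :
    fibCls Y (re P (trans h A) φ) = fibCls X φ :=
  DirFam.cls_map (S := fibFam P Λ A) h φ

theorem exists_fibCls {A : C} (z : (fibFam P Λ A).Colim) :
    ∃ (X : ConstList C Λ) (φ : Fib P (X.prod ⨯ A)), z = fibCls X φ :=
  DirFam.exists_cls z

theorem fibCls_le {A : C} {X Y : ConstList C Λ} {φ : Fib P (X.prod ⨯ A)}
    {ψ : Fib P (Y.prod ⨯ A)} :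
    fibCls X φ ≤ fibCls Y ψ ↔ ∃ (Z : ConstList C Λ) (hX : X ≤ Z) (hY : Y ≤ Z),
      re P (trans hX A) φ ≤ re P (trans hY A) ψ :=
  DirFam.cls_le_cls (S := fibFam P Λ A) (fibFam_mono P Λ A)

theorem trans_reindex {A B : C} {X Y : ConstList C Λ} (h : X ≤ Y) (f : X.prod ⨯ A ⟶ B)
    (φ : Fib P (X.prod ⨯ B)) : re P (trans h A) (re P (prod.lift prod.fst f) φ) =
      re P (prod.lift prod.fst (trans h A ≫ f)) (re P (trans h B) φ) := by
  rw [← re_comp, ← re_comp]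
  congr 2
  ext <;> simp

/-- Reindexing in the colimit, computed at a common stage. -/
noncomputable def fibRe {A B : C} :
    (homFam Λ A B).Colim → (fibFam P Λ B).Colim → (fibFam P Λ A).Colim :=
  DirFam.map₂ (S := homFam Λ A B) (T := fibFam P Λ B) (W := fibFam P Λ A)
    (fun _ f φ => re P (prod.lift prod.fst f) φ) trans_reindex

theorem fibRe_cls {A B : C} (X : ConstList C Λ) (f : X.prod ⨯ A ⟶ B) (φ : Fib P (X.prod ⨯ B)) :
    fibRe (homCls X f) (fibCls X φ) = fibCls X (re P (prod.lift prod.fst f) φ) :=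
  DirFam.map₂_cls (S := homFam Λ A B) (T := fibFam P Λ B) (W := fibFam P Λ A) _
    trans_reindex X f φ

theorem fibRe_mono {A B : C} (f : (homFam Λ A B).Colim) :
    Monotone (fibRe f : (fibFam P Λ B).Colim → _) := by
  intro z w h
  obtain ⟨X, f, rfl⟩ := exists_homCls f
  obtain ⟨Y, φ, rfl⟩ := exists_fibCls z
  obtain ⟨Y', ψ, rfl⟩ := exists_fibCls w
  obtain ⟨Z, hY, hY', h⟩ := fibCls_le.1 h
  obtain ⟨W, hX, hZ⟩ := exists_ge_ge X Z
  rw [← fibCls_trans hY, ← fibCls_trans hZ, ← fibCls_trans hY', ← fibCls_trans hZ (re P _ ψ),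
    ← homCls_trans hX, fibRe_cls, fibRe_cls]
  exact fibCls_le.2 ⟨W, le_rfl, le_rfl,
    (re P _).monotone ((re P _).monotone ((re P _).monotone h))⟩

theorem fibRe_id {A : C} (z : (fibFam P Λ A).Colim) : fibRe (homCls nil prod.snd) z = z := by
  obtain ⟨X, φ, rfl⟩ := exists_fibCls z
  rw [← homCls_snd X, fibRe_cls, prod.lift_fst_snd, re_id]

theorem fibRe_comp {A B E : C} (f : (homFam Λ A B).Colim) (g : (homFam Λ B E).Colim)
    (z : (fibFam P Λ E).Colim) : fibRe (homComp f g) z = fibRe f (fibRe g z) := by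
  obtain ⟨X, f, g, rfl, rfl⟩ := exists_homCls₂ f g
  obtain ⟨Y, φ, rfl⟩ := exists_fibCls z
  obtain ⟨Z, hX, hY⟩ := exists_ge_ge X Y
  rw [← homCls_trans hX f, ← homCls_trans hX g, ← fibCls_trans hY]
  generalize trans hX A ≫ f = f
  generalize trans hX B ≫ g = g
  generalize re P (trans hY E) φ = φ
  rw [homComp_homCls, fibRe_cls, fibRe_cls, fibRe_cls, ← re_comp]
  congr 3
  ext <;> simp

variable (P Λ) in
/-- The doctrine obtained from `P` by adding constants labelled by `Λ` of every sort. -/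
noncomputable def doctrine : (AddConst C Λ)ᵒᵖ ⥤ PartOrd.{u} where
  obj A := PartOrd.of (fibFam P Λ A.unop.obj).Colim
  map f := PartOrd.ofHom ⟨fibRe f.unop, fibRe_mono _⟩
  map_id A := by
    ext z
    exact fibRe_id z
  map_comp f g := by
    ext z
    exact fibRe_comp g.unop f.unop z

/-- The element of a fiber given by an element at the stage `X`. -/
noncomputable def fibMk {A : C} (X : ConstList C Λ) (φ : Fib P (X.prod ⨯ A)) :
    Fib (doctrine P Λ) ⟨A⟩ := fibCls X φ

theorem exists_fibMk {A : AddConst C Λ} (z : Fib (doctrine P Λ) A) :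
    ∃ (X : ConstList C Λ) (φ : Fib P (X.prod ⨯ A.obj)), z = fibMk X φ :=
  exists_fibCls z

theorem fibMk_trans {A : C} {X Y : ConstList C Λ} (h : X ≤ Y) (φ : Fib P (X.prod ⨯ A)) :
    fibMk Y (re P (trans h A) φ) = fibMk X φ :=
  fibCls_trans h φ

theorem fibMk_le {A : C} {X Y : ConstList C Λ} {φ : Fib P (X.prod ⨯ A)}
    {ψ : Fib P (Y.prod ⨯ A)} :
    fibMk X φ ≤ fibMk Y ψ ↔ ∃ (Z : ConstList C Λ) (hX : X ≤ Z) (hY : Y ≤ Z),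
      re P (trans hX A) φ ≤ re P (trans hY A) ψ :=
  fibCls_le

theorem re_fibMk {A B : C} (X : ConstList C Λ) (f : X.prod ⨯ A ⟶ B) (φ : Fib P (X.prod ⨯ B)) :
    re (doctrine P Λ) (homMk X f) (fibMk X φ) = fibMk X (re P (prod.lift prod.fst f) φ) :=
  fibRe_cls X f φ

theorem exists_fibMk₂ {A B : AddConst C Λ} (z : Fib (doctrine P Λ) A)
    (z' : Fib (doctrine P Λ) B) :
    ∃ (X : ConstList C Λ) (φ : Fib P (X.prod ⨯ A.obj)) (ψ : Fib P (X.prod ⨯ B.obj)),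
      z = fibMk X φ ∧ z' = fibMk X ψ :=
  DirFam.exists_cls₂ (S := fibFam P Λ A.obj) (T := fibFam P Λ B.obj) z z'

theorem exists_fibMk' {A : C} (z : Fib (doctrine P Λ) ⟨A⟩) :
    ∃ (X : ConstList C Λ) (φ : Fib P (X.prod ⨯ A)), z = fibMk X φ :=
  exists_fibCls z

theorem exists_fibMk₂' {A B : C} (z : Fib (doctrine P Λ) ⟨A⟩) (w : Fib (doctrine P Λ) ⟨B⟩) :
    ∃ (X : ConstList C Λ) (φ : Fib P (X.prod ⨯ A)) (ψ : Fib P (X.prod ⨯ B)),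
      z = fibMk X φ ∧ w = fibMk X ψ :=
  exists_fibMk₂ z w

/-- The inclusion of `P` into the doctrine with constants, at the empty list. -/
noncomputable def unit : DoctrineHom P (doctrine P Λ) where
  functor := incl C Λ
  preserves := incl_preserves
  trans :=
    { app := fun A => PartOrd.ofHom ⟨fun α => fibMk nil (re P prod.snd α), fun α β h =>
        fibMk_le.2 ⟨nil, le_rfl, le_rfl, (re P _).monotone ((re P _).monotone h)⟩⟩
      naturality := fun A B f => by
        ext α
        change fibMk nil (re P prod.snd (re P f.unop α)) =
          re (doctrine P Λ) (homMk nil (prod.snd ≫ f.unop)) (fibMk nil (re P prod.snd α))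
        rw [re_fibMk, ← re_comp, ← re_comp, prod.lift_snd] }

theorem unit_app {A : C} (α : Fib P A) :
    unit.app A α = (fibMk nil (re P prod.snd α) : Fib (doctrine P Λ) ⟨A⟩) := rfl

theorem unit_app' {A : C} (X : ConstList C Λ) (α : Fib P A) :
    unit.app A α = (fibMk X (re P prod.snd α) : Fib (doctrine P Λ) ⟨A⟩) := by
  rw [unit_app, ← fibMk_trans (nil_le X), ← re_comp, trans_snd]

/-! The structure of the doctrine with constants -/

theorem fibMk_isTop [Primary P] {A : C} {X : ConstList C Λ} {t : Fib P (X.prod ⨯ A)}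
    (h : IsTop t) : IsTop (fibMk X t : Fib (doctrine P Λ) ⟨A⟩) :=
  DirFam.cls_isTop (S := fibFam P Λ A) (fibFam_mono P Λ A)
    fun _ hj => Primary.re_top (trans hj A) t h

theorem fibMk_isGLB [Primary P] {A : C} {X : ConstList C Λ} {x y m : Fib P (X.prod ⨯ A)}
    (h : IsGLB {x, y} m) :
    IsGLB {(fibMk X x : Fib (doctrine P Λ) ⟨A⟩), fibMk X y} (fibMk X m) :=
  DirFam.cls_isGLB (S := fibFam P Λ A) (fibFam_mono P Λ A)
    fun _ hj => Primary.re_meet (trans hj A) x y m h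

theorem fibMk_isImp [Implicational P] {A : C} {X : ConstList C Λ} {x y c : Fib P (X.prod ⨯ A)}
    (h : IsImp x y c) :
    IsImp (fibMk X x : Fib (doctrine P Λ) ⟨A⟩) (fibMk X y) (fibMk X c) :=
  DirFam.cls_isImp (S := fibFam P Λ A) (fibFam_mono P Λ A)
    (fun _ => Primary.exists_meet _) (fun h => Primary.re_meet (trans h A))
    fun _ hj => Implicational.re_imp (trans hj A) x y c h

instance [Primary P] : Primary (doctrine P Λ) where
  exists_top A := by
    obtain ⟨t, ht⟩ := Primary.exists_top (P := P) ((nil (C := C) (Λ := Λ)).prod ⨯ A.obj)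
    exact ⟨_, fibMk_isTop ht⟩
  exists_meet A x y := by
    obtain ⟨X, x, y, rfl, rfl⟩ := exists_fibMk₂ x y
    obtain ⟨m, hm⟩ := Primary.exists_meet (P := P) _ x y
    exact ⟨_, fibMk_isGLB hm⟩
  re_top {A B} f t ht := by
    obtain ⟨X, f, rfl⟩ := exists_homMk f
    obtain ⟨t₀, ht₀⟩ := Primary.exists_top (P := P) (X.prod ⨯ B.obj)
    rw [isTop_unique ht (fibMk_isTop ht₀)]
    refine (re_fibMk X f t₀).symm ▸ fibMk_isTop (Primary.re_top _ _ ht₀)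
  re_meet {A B} f x y m h := by
    obtain ⟨X, f, rfl⟩ := exists_homMk f
    obtain ⟨Y, x, y, rfl, rfl⟩ := exists_fibMk₂ x y
    obtain ⟨Z, hX, hY⟩ := exists_ge_ge X Y
    rw [← homMk_trans hX]
    rw [← fibMk_trans hY x, ← fibMk_trans hY y] at h ⊢
    obtain ⟨m₀, hm₀⟩ := Primary.exists_meet (P := P) _ (re P (trans hY B.obj) x)
      (re P (trans hY B.obj) y)
    rw [h.unique (fibMk_isGLB hm₀)]
    have := fibMk_isGLB (Λ := Λ) (Primary.re_meet (prod.lift prod.fst (trans hX A.obj ≫ f)) _ _ _ hm₀)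
    rw [← re_fibMk, ← re_fibMk, ← re_fibMk] at this
    exact this

instance [Implicational P] : Implicational (doctrine P Λ) where
  exists_imp A x y := by
    obtain ⟨X, x, y, rfl, rfl⟩ := exists_fibMk₂ x y
    obtain ⟨c, hc⟩ := Implicational.exists_imp (P := P) _ x y
    exact ⟨_, fibMk_isImp hc⟩
  re_imp {A B} f x y c h := by
    obtain ⟨X, f, rfl⟩ := exists_homMk f
    obtain ⟨Y, x, y, rfl, rfl⟩ := exists_fibMk₂ x y
    obtain ⟨Z, hX, hY⟩ := exists_ge_ge X Y
    rw [← homMk_trans hX]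
    rw [← fibMk_trans hY x, ← fibMk_trans hY y] at h ⊢
    obtain ⟨c₀, hc₀⟩ := Implicational.exists_imp (P := P) _ (re P (trans hY B.obj) x)
      (re P (trans hY B.obj) y)
    rw [isImp_unique h (fibMk_isImp hc₀)]
    have := fibMk_isImp (Λ := Λ)
      (Implicational.re_imp (prod.lift prod.fst (trans hX A.obj ≫ f)) _ _ _ hc₀)
    rw [← re_fibMk, ← re_fibMk, ← re_fibMk] at this
    exact this

/-- The product diagram of `Y ⨯ A` and `B` with vertex `Y ⨯ (A ⨯ B)`. -/
noncomputable def stageFan (Y A B : C) :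
    IsLimit (BinaryFan.mk
      (prod.lift prod.fst (prod.snd ≫ prod.fst) : Y ⨯ (A ⨯ B) ⟶ Y ⨯ A)
      (prod.snd ≫ prod.snd : Y ⨯ (A ⨯ B) ⟶ B)) :=
  BinaryFan.isLimitMk
    (fun s => prod.lift (s.fst ≫ prod.fst) (prod.lift (s.fst ≫ prod.snd) s.snd))
    (fun s => prod.hom_ext (by simp)
      (by simpa using prod.lift_fst (s.fst ≫ prod.snd) s.snd))
    (fun s => (prod.lift_snd_assoc _ _ _).trans (prod.lift_snd _ _))
    (fun s m h h' => by
      have h₁ : m ≫ prod.fst = s.fst ≫ prod.fst := by rw [← h]; simp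
      have h₂ : (m ≫ prod.snd) ≫ prod.fst = s.fst ≫ prod.snd := by rw [← h]; simp
      have h₃ : (m ≫ prod.snd) ≫ prod.snd = s.snd := by rw [Category.assoc, h']
      refine prod.hom_ext (h₁.trans (prod.lift_fst _ _).symm) (Eq.trans ?_ (prod.lift_snd _ _).symm)
      exact prod.hom_ext (h₂.trans (prod.lift_fst _ _).symm) (h₃.trans (prod.lift_snd _ _).symm))

/-- The projection `A ⨯ B ⟶ A` at the stage `X`. -/
noncomputable abbrev stageFst (X : ConstList C Λ) (A B : C) :
    X.prod ⨯ (A ⨯ B) ⟶ X.prod ⨯ A := prod.lift prod.fst (prod.snd ≫ prod.fst)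

theorem re_incl_fst {A B : C} (X : ConstList C Λ) (γ : Fib P (X.prod ⨯ A)) :
    re (doctrine P Λ) ((incl C Λ).map (prod.fst : A ⨯ B ⟶ A)) (fibMk X γ) =
      fibMk X (re P (stageFst X A B) γ) := by
  rw [incl_map prod.fst X]
  exact re_fibMk X _ γ

theorem isEx_trans [Existential P] {A B : C} {X Y : ConstList C Λ} (h : X ≤ Y)
    {φ : Fib P (X.prod ⨯ (A ⨯ B))} {e : Fib P (X.prod ⨯ A)}
    (he : IsEx (re P (stageFst X A B)) φ e) :
    IsEx (re P (stageFst Y A B)) (re P (trans h (A ⨯ B)) φ) (re P (trans h A) e) :=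
  beckChevalley_fan (stageFan X.prod A B) (stageFan Y.prod A B) (trans h A) (trans h (A ⨯ B))
    (by ext <;> simp) (by simp) he

theorem fibMk_isEx [Existential P] {A B : C} {X : ConstList C Λ}
    {φ : Fib P (X.prod ⨯ (A ⨯ B))} {e : Fib P (X.prod ⨯ A)}
    (he : IsEx (re P (stageFst X A B)) φ e) :
    IsEx (re (doctrine P Λ) ((incl C Λ).map (prod.fst : A ⨯ B ⟶ A)))
      (fibMk X φ : Fib (doctrine P Λ) ⟨A ⨯ B⟩) (fibMk X e) := by
  intro γ
  obtain ⟨Y, γ, rfl⟩ := exists_fibMk' (A := A) γ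
  refine Iff.trans ?_ (Iff.of_eq (congrArg (fun t => fibMk X φ ≤ t) (re_incl_fst Y γ).symm))
  refine fibMk_le.trans (Iff.trans ?_ fibMk_le.symm)
  refine exists_congr fun Z => exists_congr fun hX => exists_congr fun hY => ?_
  rw [isEx_trans hX he, ← re_comp, ← re_comp]
  have : stageFst Z A B ≫ trans hY A = trans hY (A ⨯ B) ≫ stageFst Y A B := by
    ext <;> simp
  rw [this]

theorem exists_stage_ex [Existential P] {A B : C} (X : ConstList C Λ)
    (φ : Fib P (X.prod ⨯ (A ⨯ B))) : ∃ e, IsEx (re P (stageFst X A B)) φ e :=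
  exists_ex_fan (stageFan X.prod A B) φ

instance [Existential P] : Existential (doctrine P Λ) :=
  existential_of_fans (C := AddConst C Λ) (P := doctrine P Λ)
    (fun A B => ⟨A.obj ⨯ B.obj⟩)
    (fun A B => (incl C Λ).map (prod.fst : A.obj ⨯ B.obj ⟶ A.obj))
    (fun A B => (incl C Λ).map (prod.snd : A.obj ⨯ B.obj ⟶ B.obj))
    (fun A B => isLimitFan (prodFan A.obj B.obj))
    (by
      intro A B φ
      obtain ⟨X, φ, rfl⟩ := exists_fibMk' φ
      obtain ⟨e, he⟩ := exists_stage_ex X φ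
      exact ⟨_, fibMk_isEx he⟩)
    (by
      intro A' A B f g hp hq φ e he
      obtain ⟨X, f, rfl⟩ := exists_homMk f
      obtain ⟨Y, φ, rfl⟩ := exists_fibMk' φ
      obtain ⟨Z, hX, hY⟩ := exists_ge_ge X Y
      rw [← homMk_trans hX] at hp ⊢
      rw [← fibMk_trans hY] at he ⊢
      generalize trans hX A'.obj ≫ f = f at hp ⊢
      generalize re P (trans hY (A.obj ⨯ B.obj)) φ = φ at he ⊢
      let g₀ : Z.prod ⨯ (A'.obj ⨯ B.obj) ⟶ A.obj ⨯ B.obj :=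
        prod.lift (stageFst Z A'.obj B.obj ≫ f) (prod.snd ≫ prod.snd)
      have hg : g = homMk Z g₀ := by
        refine fan_hom_ext (isLimitFan (prodFan A.obj B.obj)) (hp.trans ?_) (hq.trans ?_)
        · rw [incl_map prod.fst Z, incl_map prod.fst Z]
          refine (homMk_comp Z _ _).trans (Eq.trans ?_ (homMk_comp Z _ _).symm)
          rw [prod.lift_snd_assoc, prod.lift_fst]
        · rw [incl_map prod.snd Z, incl_map prod.snd Z]
          refine Eq.trans ?_ (homMk_comp Z _ _).symm
          rw [prod.lift_snd_assoc, prod.lift_snd]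
      subst hg
      obtain ⟨e₀, he₀⟩ := exists_stage_ex Z φ
      rw [he.unique (fibMk_isEx he₀)]
      have := fibMk_isEx (Λ := Λ) (beckChevalley_fan (stageFan Z.prod A.obj B.obj)
        (stageFan Z.prod A'.obj B.obj) (prod.lift prod.fst f) (prod.lift prod.fst g₀)
        (by ext <;> simp [g₀]) (by simp [g₀]) he₀)
      rw [← re_fibMk, ← re_fibMk] at this
      exact this)
    (by
      intro A B φ m β e n he hm hn
      obtain ⟨X, φ, β, rfl, rfl⟩ := exists_fibMk₂' (B := A.obj) φ β
      obtain ⟨e₀, he₀⟩ := exists_stage_ex X φ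
      obtain rfl := he.unique (fibMk_isEx he₀)
      obtain ⟨n₀, hn₀⟩ := Primary.exists_meet (P := P) _ e₀ β
      obtain rfl := hn.unique (fibMk_isGLB hn₀)
      obtain ⟨m₀, hm₀⟩ := Primary.exists_meet (P := P) _ φ (re P (stageFst X A.obj B.obj) β)
      have := fibMk_isGLB (Λ := Λ) hm₀
      rw [← re_incl_fst] at this
      obtain rfl := hm.unique this
      exact fibMk_isEx (frobenius_fan (stageFan X.prod A.obj B.obj) he₀ hm₀ hn₀))

theorem unit_isImpEx [Implicational P] [Existential P] :
    (unit : DoctrineHom P (doctrine P Λ)).IsImpEx where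
  top A t h := fibMk_isTop (Primary.re_top _ _ h)
  meet A x y m h := fibMk_isGLB (Primary.re_meet _ _ _ _ h)
  imp A x y c h := fibMk_isImp (Implicational.re_imp _ _ _ _ h)
  ex A B φ e h := fibMk_isEx (beckChevalley_fan (prodFan A B) (stageFan nil.prod A B) prod.snd
    prod.snd (by simp) rfl h)

end AddConst

/-! ### Adding axioms -/

namespace DirFam

variable {ι : Type a} [Preorder ι] [IsDirectedOrder ι] {S T : DirFam.{a, b} ι}

/-- A map defined stage by stage. -/
def map₁ (g : ∀ i, S.obj i → T.obj i)
    (hg : ∀ {i j : ι} (h : i ≤ j) (x : S.obj i), T.map h (g i x) = g j (S.map h x)) :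
    S.Colim → T.Colim :=
  Quotient.lift (s := S.rel) (fun x => cls x.1 (g x.1 x.2)) (by
    rintro x y ⟨k, hx, hy, e⟩
    exact cls_eq.2 ⟨k, hx, hy, by rw [hg, hg, e]⟩)

theorem map₁_cls (g : ∀ i, S.obj i → T.obj i)
    (hg : ∀ {i j : ι} (h : i ≤ j) (x : S.obj i), T.map h (g i x) = g j (S.map h x))
    (i : ι) (x : S.obj i) : map₁ g hg (cls i x) = cls i (g i x) := rfl

end DirFam

namespace AddAx

variable {E : Type u} [Category.{v} E] {Q : Eᵒᵖ ⥤ PartOrd.{w}} [Primary Q]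

/-- Binary meets in the fibers. -/
noncomputable def meet {A : E} (x y : Fib Q A) : Fib Q A := (Primary.exists_meet A x y).choose

theorem meet_isGLB {A : E} (x y : Fib Q A) : IsGLB {x, y} (meet x y) :=
  (Primary.exists_meet A x y).choose_spec

theorem meet_le_left {A : E} (x y : Fib Q A) : meet x y ≤ x := (isGLB_pair_iff.1 (meet_isGLB x y)).1

theorem meet_le_right {A : E} (x y : Fib Q A) : meet x y ≤ y :=
  (isGLB_pair_iff.1 (meet_isGLB x y)).2.1

theorem le_meet {A : E} {x y z : Fib Q A} (h : z ≤ x) (h' : z ≤ y) : z ≤ meet x y :=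
  (isGLB_pair_iff.1 (meet_isGLB x y)).2.2 z h h'

theorem re_meet {A B : E} (f : A ⟶ B) (x y : Fib Q B) :
    re Q f (meet x y) = meet (re Q f x) (re Q f y) :=
  (Primary.re_meet f _ _ _ (meet_isGLB x y)).unique (meet_isGLB _ _)

theorem exists_conj {A : E} {κ : Type w} (ψ : κ → Fib Q A) (U : Finset κ) :
    ∃ m, IsGLB (Set.image ψ (U : Set κ)) m := by
  classical
  induction U using Finset.induction_on with
  | empty =>
    obtain ⟨t, ht⟩ := Primary.exists_top (P := Q) A
    exact ⟨t, by simpa [IsTop] using ht⟩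
  | insert i U _ ih =>
    obtain ⟨m, hm⟩ := ih
    refine ⟨meet (ψ i) m, ?_⟩
    rw [Finset.coe_insert, Set.image_insert_eq]
    constructor
    · rintro _ (rfl | h)
      · exact meet_le_left _ _
      · exact (meet_le_right _ _).trans (hm.1 h)
    · intro z hz
      exact le_meet (hz (Set.mem_insert _ _)) (hm.2 fun y hy => hz (Set.mem_insert_of_mem _ hy))

/-- The meet of finitely many members of a family. -/
noncomputable def conj {A : E} {κ : Type w} (ψ : κ → Fib Q A) (U : Finset κ) : Fib Q A :=
  (exists_conj ψ U).choose

theorem conj_isGLB {A : E} {κ : Type w} (ψ : κ → Fib Q A) (U : Finset κ) :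
    IsGLB (Set.image ψ (U : Set κ)) (conj ψ U) :=
  (exists_conj ψ U).choose_spec

variable {T : E} (hT : IsTerminal T) {κ : Type w} (ψ : κ → Fib Q T)

/-- The meet of finitely many axioms, over the object `A`. -/
noncomputable def ax (U : Finset κ) (A : E) : Fib Q A := re Q (hT.from A) (conj ψ U)

theorem ax_anti {U V : Finset κ} (h : U ≤ V) (A : E) : ax hT ψ V A ≤ ax hT ψ U A :=
  (re Q _).monotone
    ((conj_isGLB ψ U).2 fun _ hx => (conj_isGLB ψ V).1 (Set.image_mono (Finset.coe_subset.2 h) hx))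

theorem re_ax {A B : E} (f : A ⟶ B) (U : Finset κ) : re Q f (ax hT ψ U B) = ax hT ψ U A := by
  rw [ax, ← re_comp, hT.comp_from, ax]

theorem le_ax_empty {A : E} (α : Fib Q A) : α ≤ ax hT ψ ∅ A := by
  refine Primary.re_top _ _ ?_ α
  have := conj_isGLB ψ ∅
  rw [Finset.coe_empty, Set.image_empty, isGLB_empty_iff] at this
  exact this

/-- At the stage given by a finite set of axioms, one takes the elements of the fiber below the
meet of these axioms; transition maps take the meet with the further axioms. -/
@[reducible] noncomputable def fam (A : E) : DirFam.{w, w} (Finset κ) where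
  obj U := {α : Fib Q A // α ≤ ax hT ψ U A}
  map {_ V} _ α := ⟨meet α.1 (ax hT ψ V A), meet_le_right _ _⟩
  map_self α := Subtype.ext (le_antisymm (meet_le_left _ _) (le_meet le_rfl α.2))
  map_map _ h' α := Subtype.ext (le_antisymm
    (le_meet ((meet_le_left _ _).trans (meet_le_left _ _)) (meet_le_right _ _))
    (le_meet (le_meet (meet_le_left _ _) ((meet_le_right _ _).trans (ax_anti hT ψ h' A)))
      (meet_le_right _ _)))

theorem fam_mono (A : E) {U V : Finset κ} (h : U ≤ V) : Monotone ((fam hT ψ A).map h) :=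
  fun _ _ h' => le_meet ((meet_le_left _ _).trans h') (meet_le_right _ _)

noncomputable instance (A : E) : PartialOrder (fam hT ψ A).Colim :=
  DirFam.partialOrder (S := fam hT ψ A) (fam_mono hT ψ A)

/-- Reindexing, computed stage by stage. -/
noncomputable def famRe {A B : E} (f : A ⟶ B) : (fam hT ψ B).Colim → (fam hT ψ A).Colim :=
  DirFam.map₁ (S := fam hT ψ B) (T := fam hT ψ A)
    (fun U α => ⟨re Q f α.1, re_ax hT ψ f U ▸ (re Q f).monotone α.2⟩)
    (fun {_ V} _ α => Subtype.ext (by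
      change meet (re Q f α.1) (ax hT ψ V A) = re Q f (meet α.1 (ax hT ψ V B))
      rw [re_meet, re_ax]))

variable {hT ψ} in
/-- The class of an element of the fiber at the stage of no axioms. -/
noncomputable def q {A : E} (α : Fib Q A) : (fam hT ψ A).Colim :=
  DirFam.cls (S := fam hT ψ A) ∅ ⟨α, le_ax_empty hT ψ α⟩

theorem q_surjective {A : E} (z : (fam hT ψ A).Colim) : ∃ α, z = q α := by
  obtain ⟨U, α, rfl⟩ := DirFam.exists_cls z
  refine ⟨α.1, ?_⟩
  have h : (∅ : Finset κ) ≤ U := Finset.empty_subset U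
  refine Eq.trans ?_ (DirFam.cls_map (S := fam hT ψ A) h _)
  congr 1
  exact Subtype.ext (le_antisymm (le_meet le_rfl α.2) (meet_le_left _ _))

theorem famRe_q {A B : E} (f : A ⟶ B) (α : Fib Q B) :
    famRe hT ψ f (q α) = q (re Q f α) := rfl

theorem q_le {A : E} {α β : Fib Q A} :
    (q α : (fam hT ψ A).Colim) ≤ q β ↔ ∃ U, meet α (ax hT ψ U A) ≤ β := by
  refine (DirFam.cls_le_cls (S := fam hT ψ A) (fam_mono hT ψ A)).trans ⟨?_, ?_⟩
  · rintro ⟨U, _, _, h⟩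
    exact ⟨U, le_trans h (meet_le_left _ _)⟩
  · rintro ⟨U, h⟩
    exact ⟨U, Finset.empty_subset U, Finset.empty_subset U, le_meet h (meet_le_right _ _)⟩

theorem q_mono {A : E} {α β : Fib Q A} (h : α ≤ β) : (q α : (fam hT ψ A).Colim) ≤ q β :=
  (q_le hT ψ).2 ⟨∅, (meet_le_left _ _).trans h⟩

theorem famRe_mono {A B : E} (f : A ⟶ B) : Monotone (famRe hT ψ f) := by
  intro z z' h
  obtain ⟨α, rfl⟩ := q_surjective hT ψ z
  obtain ⟨β, rfl⟩ := q_surjective hT ψ z'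
  obtain ⟨U, h⟩ := (q_le hT ψ).1 h
  rw [famRe_q, famRe_q]
  refine (q_le hT ψ).2 ⟨U, ?_⟩
  rw [← re_ax hT ψ f, ← re_meet]
  exact (re Q f).monotone h

/-- The doctrine obtained from `Q` by adding the axioms `ψ`. -/
noncomputable def doctrine : Eᵒᵖ ⥤ PartOrd.{w} where
  obj A := PartOrd.of (fam hT ψ A.unop).Colim
  map f := PartOrd.ofHom ⟨famRe hT ψ f.unop, famRe_mono hT ψ _⟩
  map_id A := by
    ext z
    obtain ⟨α, rfl⟩ := q_surjective hT ψ z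
    exact (famRe_q hT ψ (𝟙 A.unop) α).trans (congrArg q (re_id Q α))
  map_comp f g := by
    ext z
    obtain ⟨α, rfl⟩ := q_surjective hT ψ z
    exact (famRe_q hT ψ (g.unop ≫ f.unop) α).trans (congrArg q (re_comp Q _ _ α))

/-- The morphism from `Q`, which is the identity on the base category. -/
noncomputable def unit : DoctrineHom Q (doctrine hT ψ) where
  functor := 𝟭 E
  preserves := inferInstance
  trans :=
    { app := fun A => PartOrd.ofHom ⟨fun α => (q α : (fam hT ψ A.unop).Colim),
        fun _ _ h => q_mono hT ψ h⟩
      naturality := fun _ _ _ => rfl }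

/-! The structure of the doctrine with axioms -/

/-- The class of an element of a fiber of `Q`, as an element of the new fiber. -/
noncomputable abbrev qMk {A : E} (α : Fib Q A) : Fib (doctrine hT ψ) A :=
  (q α : (fam hT ψ A).Colim)

theorem exists_qMk {A : E} (z : Fib (doctrine hT ψ) A) : ∃ α, z = qMk hT ψ α :=
  q_surjective hT ψ z

theorem qMk_le {A : E} {α β : Fib Q A} :
    qMk hT ψ α ≤ qMk hT ψ β ↔ ∃ U, meet α (ax hT ψ U A) ≤ β := q_le hT ψ

theorem re_qMk {A B : E} (f : A ⟶ B) (α : Fib Q B) :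
    re (doctrine hT ψ) f (qMk hT ψ α) = qMk hT ψ (re Q f α) := rfl

theorem qMk_isTop {A : E} {t : Fib Q A} (h : IsTop t) : IsTop (qMk hT ψ t) := by
  intro z
  obtain ⟨α, rfl⟩ := exists_qMk hT ψ z
  exact q_mono hT ψ (h α)

theorem qMk_isGLB {A : E} {x y m : Fib Q A} (h : IsGLB {x, y} m) :
    IsGLB {qMk hT ψ x, qMk hT ψ y} (qMk hT ψ m) := by
  classical
  obtain ⟨h₁, h₂, h₃⟩ := isGLB_pair_iff.1 h
  refine isGLB_pair_iff.2 ⟨q_mono hT ψ h₁, q_mono hT ψ h₂, fun z hx hy => ?_⟩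
  obtain ⟨α, rfl⟩ := exists_qMk hT ψ z
  obtain ⟨U, hU⟩ := (qMk_le hT ψ).1 hx
  obtain ⟨V, hV⟩ := (qMk_le hT ψ).1 hy
  refine (qMk_le hT ψ).2 ⟨U ∪ V, h₃ _ (le_trans ?_ hU) (le_trans ?_ hV)⟩
  · exact le_meet (meet_le_left _ _)
      ((meet_le_right _ _).trans (ax_anti hT ψ Finset.subset_union_left A))
  · exact le_meet (meet_le_left _ _)
      ((meet_le_right _ _).trans (ax_anti hT ψ Finset.subset_union_right A))

theorem qMk_isImp {A : E} {x y c : Fib Q A} (h : IsImp x y c) :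
    IsImp (qMk hT ψ x) (qMk hT ψ y) (qMk hT ψ c) := by
  intro z n hn
  obtain ⟨α, rfl⟩ := exists_qMk hT ψ z
  obtain rfl := hn.unique (qMk_isGLB hT ψ (meet_isGLB α x))
  rw [qMk_le, qMk_le]
  refine exists_congr fun U => ?_
  have e : meet (meet α (ax hT ψ U A)) x = meet (meet α x) (ax hT ψ U A) :=
    le_antisymm
      (le_meet (le_meet ((meet_le_left _ _).trans (meet_le_left _ _)) (meet_le_right _ _))
        ((meet_le_left _ _).trans (meet_le_right _ _)))
      (le_meet (le_meet ((meet_le_left _ _).trans (meet_le_left _ _)) (meet_le_right _ _))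
        ((meet_le_left _ _).trans (meet_le_right _ _)))
  rw [h _ _ (meet_isGLB _ x), e]

theorem qMk_isEx [HasFiniteProducts E] [Existential Q] {A B : E} {φ : Fib Q (A ⨯ B)} {e : Fib Q A}
    (h : IsEx (re Q (prod.fst : A ⨯ B ⟶ A)) φ e) :
    IsEx (re (doctrine hT ψ) (prod.fst : A ⨯ B ⟶ A)) (qMk hT ψ φ) (qMk hT ψ e) := by
  intro z
  obtain ⟨γ, rfl⟩ := exists_qMk hT ψ z
  rw [re_qMk, qMk_le, qMk_le]
  refine exists_congr fun U => ?_
  have hm := meet_isGLB φ (re Q (prod.fst : A ⨯ B ⟶ A) (ax hT ψ U A))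
  have := Existential.frobenius A B φ _ e _ _ h hm (meet_isGLB e _)
  rw [re_ax] at this
  exact this γ

instance : Primary (doctrine hT ψ) where
  exists_top A := by
    obtain ⟨t, ht⟩ := Primary.exists_top (P := Q) A
    exact ⟨_, qMk_isTop hT ψ ht⟩
  exists_meet A x y := by
    obtain ⟨x, rfl⟩ := exists_qMk hT ψ x
    obtain ⟨y, rfl⟩ := exists_qMk hT ψ y
    exact ⟨_, qMk_isGLB hT ψ (meet_isGLB x y)⟩
  re_top {A B} f t ht := by
    obtain ⟨t₀, ht₀⟩ := Primary.exists_top (P := Q) B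
    obtain rfl := isTop_unique ht (qMk_isTop hT ψ ht₀)
    exact qMk_isTop hT ψ (Primary.re_top f _ ht₀)
  re_meet {A B} f x y m h := by
    obtain ⟨x, rfl⟩ := exists_qMk hT ψ x
    obtain ⟨y, rfl⟩ := exists_qMk hT ψ y
    obtain rfl := h.unique (qMk_isGLB hT ψ (meet_isGLB x y))
    exact qMk_isGLB hT ψ (Primary.re_meet f _ _ _ (meet_isGLB x y))

instance [Implicational Q] : Implicational (doctrine hT ψ) where
  exists_imp A x y := by
    obtain ⟨x, rfl⟩ := exists_qMk hT ψ x
    obtain ⟨y, rfl⟩ := exists_qMk hT ψ y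
    obtain ⟨c, hc⟩ := Implicational.exists_imp A x y
    exact ⟨_, qMk_isImp hT ψ hc⟩
  re_imp {A B} f x y c h := by
    obtain ⟨x, rfl⟩ := exists_qMk hT ψ x
    obtain ⟨y, rfl⟩ := exists_qMk hT ψ y
    obtain ⟨c₀, hc₀⟩ := Implicational.exists_imp B x y
    obtain rfl := isImp_unique h (qMk_isImp hT ψ hc₀)
    exact qMk_isImp hT ψ (Implicational.re_imp f _ _ _ hc₀)

instance [HasFiniteProducts E] [Existential Q] : Existential (doctrine hT ψ) where
  exists_ex A B φ := by
    obtain ⟨φ, rfl⟩ := exists_qMk hT ψ φ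
    obtain ⟨e, he⟩ := Existential.exists_ex A B φ
    exact ⟨_, qMk_isEx hT ψ he⟩
  beckChevalley {A A'} B f φ e h := by
    obtain ⟨φ, rfl⟩ := exists_qMk hT ψ φ
    obtain ⟨e₀, he₀⟩ := Existential.exists_ex A' B φ
    obtain rfl := h.unique (qMk_isEx hT ψ he₀)
    exact qMk_isEx hT ψ (Existential.beckChevalley B f _ _ he₀)
  frobenius A B φ β e n m h hm hn := by
    obtain ⟨φ, rfl⟩ := exists_qMk hT ψ φ
    obtain ⟨β, rfl⟩ := exists_qMk hT ψ β
    obtain ⟨e₀, he₀⟩ := Existential.exists_ex A B φ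
    obtain rfl := h.unique (qMk_isEx hT ψ he₀)
    obtain rfl := hn.unique (qMk_isGLB hT ψ (meet_isGLB e₀ β))
    obtain rfl := hm.unique (qMk_isGLB hT ψ (meet_isGLB φ (re Q prod.fst β)))
    exact qMk_isEx hT ψ (Existential.frobenius A B φ β _ _ _ he₀ (meet_isGLB _ _) (meet_isGLB _ _))

theorem unit_isImpEx [HasFiniteProducts E] [Implicational Q] [Existential Q] :
    (unit hT ψ).IsImpEx where
  top _ _ h := qMk_isTop hT ψ h
  meet _ _ _ _ h := qMk_isGLB hT ψ h
  imp _ _ _ _ h := qMk_isImp hT ψ h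
  ex _ _ _ _ h := qMk_isEx hT ψ h

end AddAx

/-! ### The doctrine with Henkin axioms -/

section Henkin

variable {C : Type u} [SmallCategory C] (P : Cᵒᵖ ⥤ PartOrd.{u})

/-- The labels of the constants are the ordinals below the cardinality of the disjoint union of
the fibers of `P`. -/
abbrev Labels : Type u := (Cardinal.mk (Σ X : C, Fib P X)).ord.ToType

variable {P}

/-- The implication in a fiber. -/
noncomputable def himp [Implicational P] {A : C} (x y : Fib P A) : Fib P A :=
  (Implicational.exists_imp A x y).choose

theorem himp_isImp [Implicational P] {A : C} (x y : Fib P A) : IsImp x y (himp x y) :=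
  (Implicational.exists_imp A x y).choose_spec

variable [HasFiniteProducts C]

/-- The value at `φ` of the left adjoint to reindexing along the projection `A ⨯ B ⟶ A`. -/
noncomputable def ex [Existential P] {A B : C} (φ : Fib P (A ⨯ B)) : Fib P A :=
  (Existential.exists_ex A B φ).choose

theorem ex_isEx [Existential P] {A B : C} (φ : Fib P (A ⨯ B)) :
    IsEx (re P (prod.fst : A ⨯ B ⟶ A)) φ (ex φ) :=
  (Existential.exists_ex A B φ).choose_spec

variable (P) in
/-- The choices in the construction: for every object `B` a listing, indexed by the labels, of the
elements of the fiber over `B` of the doctrine with constants, with chosen representatives `φ B j`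
at the stages `X B j`. The labels `d B j` are then determined: `d B j` is the least label greater
than all `d B h` with `h < j` and than all labels which occur in the lists `X B k` with `k ≤ j`. -/
structure HenkinChoice where
  X : C → Labels P → ConstList C (Labels P)
  φ : ∀ (B : C) (j : Labels P), Fib P ((X B j).prod ⨯ B)
  surj : ∀ (B : C) (z : Fib (AddConst.doctrine P (Labels P)) ⟨B⟩),
    ∃ j, AddConst.fibMk (X B j) (φ B j) = z
  d : C → Labels P → Labels P
  d_isLeast : ∀ (B : C) (j : Labels P), IsLeast
    {δ | (∀ h < j, d B h < δ) ∧ ∀ k ≤ j, ∀ p ∈ (X B k).1, p.2 < δ} (d B j)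

namespace HenkinChoice

open ConstList

variable (𝓗 : HenkinChoice P)

theorem notMem (B : C) (j : Labels P) : (B, 𝓗.d B j) ∉ (𝓗.X B j).1 := fun h =>
  lt_irrefl _ ((𝓗.d_isLeast B j).1.2 j le_rfl _ h)

/-- The list `X B j` followed by the new entry `(B, d B j)`. -/
def star (B : C) (j : Labels P) : ConstList C (Labels P) := (𝓗.X B j).snoc _ (𝓗.notMem B j)

/-- The arrow from the product of the list `star B j` to the product of `X B j` and `B`. -/
noncomputable def starHom (B : C) (j : Labels P) :
    (𝓗.star B j).prod ⨯ (⊤_ C) ⟶ (𝓗.X B j).prod ⨯ B :=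
  prod.lift (prod.fst ≫ restr (le_snoc _ _ (𝓗.notMem B j)))
    (prod.fst ≫ (𝓗.star B j).proj (B, 𝓗.d B j) (mem_snoc _ _ (𝓗.notMem B j)))

variable [Implicational P] [Existential P]

/-- The Henkin axiom `(∃ φ) → φ` for `φ B j`, where the variable of sort `B` is substituted by the
constant `(B, d B j)`; it lives over the terminal object. -/
noncomputable def henkinAx (p : C × Labels P) :
    Fib (AddConst.doctrine P (Labels P)) ⟨⊤_ C⟩ :=
  AddConst.fibMk (𝓗.star p.1 p.2) (re P (𝓗.starHom p.1 p.2)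
    (himp (re P prod.fst (ex (𝓗.φ p.1 p.2))) (𝓗.φ p.1 p.2)))

/-- The doctrine obtained from `P` by adding the constants and then the Henkin axioms. -/
noncomputable def doctrine : (AddConst C (Labels P))ᵒᵖ ⥤ PartOrd.{u} :=
  AddAx.doctrine (AddConst.isTerminal terminalIsTerminal) 𝓗.henkinAx

noncomputable instance : Implicational 𝓗.doctrine := by unfold doctrine; infer_instance

noncomputable instance : Existential 𝓗.doctrine := by unfold doctrine; infer_instance

/-- The morphism from `P`. -/
noncomputable def unit : DoctrineHom P 𝓗.doctrine :=
  AddConst.unit.comp (AddAx.unit (AddConst.isTerminal terminalIsTerminal) 𝓗.henkinAx)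

end HenkinChoice

end Henkin

/-! ### Categories of implicational existential morphisms -/

section HomCat

variable {C : Type u} [Category.{v} C] [HasFiniteProducts C]
  {D : Type u'} [Category.{v'} D] [HasFiniteProducts D]
  {E : Type a} [Category.{b} E]

/-- Preservation of existential quantifiers along the projections of any product diagram. -/
theorem DoctrineHom.IsImpEx.ex_fan {R : Dᵒᵖ ⥤ PartOrd.{w}} {S : Eᵒᵖ ⥤ PartOrd.{w}}
    {G : DoctrineHom R S} (hG : G.IsImpEx) {A B X : D} {p : X ⟶ A} {q : X ⟶ B}
    (h : IsLimit (BinaryFan.mk p q)) {φ : Fib R X} {e : Fib R A} (he : IsEx (re R p) φ e) :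
    IsEx (re S (G.functor.map p)) (G.app X φ) (G.app A e) := by
  rw [← isEx_iso' _ (fanIso_fst (prodFan A B) h)] at he
  have := hG.ex _ _ _ _ he
  rw [DoctrineHom.app_re] at this
  rwa [← isEx_iso' (G.functor.mapIso (fanIso (prodFan A B) h)) (p' := G.functor.map prod.fst)
    (by rw [Functor.mapIso_hom, ← G.functor.map_comp, fanIso_fst])]

theorem DoctrineHom.IsImpEx.comp {P : Cᵒᵖ ⥤ PartOrd.{w}} {R : Dᵒᵖ ⥤ PartOrd.{w}}
    {S : Eᵒᵖ ⥤ PartOrd.{w}} {F : DoctrineHom P R} {G : DoctrineHom R S} (hF : F.IsImpEx)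
    (hG : G.IsImpEx) : (F.comp G).IsImpEx where
  top A t h := hG.top _ _ (hF.top A t h)
  meet A x y m h := hG.meet _ _ _ _ (hF.meet A x y m h)
  imp A x y c h := hG.imp _ _ _ _ (hF.imp A x y c h)
  ex A B φ e h := by
    have := F.preserves
    exact hG.ex_fan (mapIsLimitOfPreservesOfIsLimit F.functor _ _ (prodFan A B)) (hF.ex A B φ e h)

/-- The category of the implicational existential morphisms from `P` to `R` and of all the
2-cells between them. -/
abbrev ImpExHom (P : Cᵒᵖ ⥤ PartOrd.{w}) (R : Dᵒᵖ ⥤ PartOrd.{w}) :=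
  ObjectProperty.FullSubcategory (fun F : DoctrineHom P R => F.IsImpEx)

/-- Precomposition with an implicational existential morphism. -/
def ImpExHom.precomp {P : Cᵒᵖ ⥤ PartOrd.{w}} {R : Dᵒᵖ ⥤ PartOrd.{w}} (F : ImpExHom P R)
    (S : Eᵒᵖ ⥤ PartOrd.{w}) [HasFiniteProducts E] : ImpExHom R S ⥤ ImpExHom P S :=
  ObjectProperty.lift _ (ObjectProperty.ι _ ⋙ F.obj.precomp S)
    (fun G => F.property.comp G.property)

/-- Precomposition with `F` on coslice categories, for `H` equal to the composite of `F` and `G`: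
a 2-cell from `G` to `M` is mapped to its whiskering with `F`, a 2-cell from `H` to the
composite of `F` and `M`. -/
def ImpExHom.coslice {P : Cᵒᵖ ⥤ PartOrd.{w}} {R : Dᵒᵖ ⥤ PartOrd.{w}} (F : ImpExHom P R)
    {S : Eᵒᵖ ⥤ PartOrd.{w}} [HasFiniteProducts E] (G : ImpExHom R S) (H : ImpExHom P S)
    (h : (F.precomp S).obj G = H) : Under G ⥤ Under H :=
  Under.post (F.precomp S) ⋙ Under.map (eqToHom h.symm)

end HomCat

/-- The morphism from `P` to the doctrine with Henkin constants and axioms, as an implicational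
existential morphism. -/
noncomputable def HenkinChoice.hom {C : Type u} [SmallCategory C] [HasFiniteProducts C]
    {P : Cᵒᵖ ⥤ PartOrd.{u}} (𝓗 : HenkinChoice P) [Implicational P] [Existential P] :
    ImpExHom P 𝓗.doctrine :=
  ⟨𝓗.unit, AddConst.unit_isImpEx.comp (AddAx.unit_isImpEx _ _)⟩

end HenkinDct

open HenkinDct

/-! Adding constants to a doctrine is free in a precise sense. An arrow of the new base at the stage
`X` is an old arrow with the constants of `X` plugged in: it factors as the graph `a ↦ (constants of
X, a)` followed by an arrow of `C`. In the same way every element of a new fiber is the reindexing,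
along such a graph, of an element coming from `P` (`graph_comp_incl`, `re_graph_unit`). The graph
itself is the pairing of the identity with a tuple of global elements (`graph_fst`, `graph_snd`). So
a 1-arrow out of the doctrine with constants amounts to its restriction to `P` together with
compatible values of the constants (`AddConst.desc`), and a 2-cell is a 2-cell between the
restrictions which respects those values (`extendNat`). Adding axioms changes neither objects nor
arrows: a 1-arrow factors through the new doctrine as soon as it maps every axiom to a top element
(`AddAx.desc`).

The role of `G` in the coslice is to fix the values of the constants. Faithfulness is immediate,
because the base functor from `C` is the identity on objects. For fullness, let `θ : G ⟶ M` and `θ'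
: G ⟶ N`, and let `ζ` be a 2-cell between the restrictions of `M` and `N` which carries `θ` to `θ'`.
Naturality of `θ` and `θ'` at a tuple of constants shows that `ζ` commutes with that tuple after
precomposition with the component of `θ` at the terminal object. This component is an arrow between
terminal objects, hence invertible, and can be cancelled (`exists_extension`).

For essential surjectivity, let `θ` be a 2-cell from the restriction of `G` to a 1-arrow `K` on `P`.
Transporting the values of the constants in `G` along `θ` interprets them in `K`, so `K` extends to
the doctrine with constants and `θ` becomes a 2-cell into this extension. An axiom is top in `G`;
the inequality in the 2-cell, read at the terminal object where `θ` is invertible, makes it top in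
the extension as well (`desc_henkinAx_isTop`). Hence the extension passes to the doctrine with
axioms, and it restricts to `K` through identity components. -/

namespace HenkinDct

/-- Preservation of existential quantifiers can be checked on any choice of a product diagram. -/
theorem DoctrineHom.ex_of_fan {C : Type u} [Category.{v} C] {D : Type u'} [Category.{v'} D]
    {P : Cᵒᵖ ⥤ PartOrd.{w}} {R : Dᵒᵖ ⥤ PartOrd.{w}} (F : DoctrineHom P R) {A B X X' : C}
    {p : X ⟶ A} {q : X ⟶ B} (h : IsLimit (BinaryFan.mk p q))
    {p' : X' ⟶ A} {q' : X' ⟶ B} (h' : IsLimit (BinaryFan.mk p' q'))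
    (H : ∀ (φ : Fib P X) (e : Fib P A), IsEx (re P p) φ e →
      IsEx (re R (F.functor.map p)) (F.app X φ) (F.app A e))
    {φ : Fib P X'} {e : Fib P A} (he : IsEx (re P p') φ e) :
    IsEx (re R (F.functor.map p')) (F.app X' φ) (F.app A e) := by
  rw [← isEx_iso' (fanIso h h') (fanIso_fst h h')] at he
  rw [← isEx_iso' (F.functor.mapIso (fanIso h h')) (p' := F.functor.map p)
    (by rw [Functor.mapIso_hom, ← F.functor.map_comp, fanIso_fst]), Functor.mapIso_hom,
    ← F.app_re]
  exact H _ _ he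

namespace AddConst

open ConstList

/-! ### Graphs of the constants -/

section Graph

variable {C : Type u} [SmallCategory C] [HasFiniteProducts C] {Λ : Type u}

theorem homMk_comp_incl {A B E : C} (X : ConstList C Λ) (k : X.prod ⨯ A ⟶ B) (r : B ⟶ E) :
    homMk X k ≫ (incl C Λ).map r = homMk X (k ≫ r) := by
  rw [incl_map r X]
  refine (homMk_comp X k _).trans ?_
  rw [prod.lift_snd_assoc]

/-- The arrow `a ↦ (constants of X, a)`. -/
noncomputable def graph (X : ConstList C Λ) (A : C) :
    (incl C Λ).obj A ⟶ (incl C Λ).obj (X.prod ⨯ A) :=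
  homMk X (𝟙 (X.prod ⨯ A))

/-- This is the factorization that reduces statements about all arrows to two cases: arrows of `C`
and graphs. -/
theorem graph_comp_incl {A B : C} (X : ConstList C Λ) (f : X.prod ⨯ A ⟶ B) :
    graph X A ≫ (incl C Λ).map f = homMk X f :=
  (homMk_comp_incl X _ f).trans (by rw [Category.id_comp])

theorem exists_graph_comp_incl {A B : C} (f : (incl C Λ).obj A ⟶ (incl C Λ).obj B) :
    ∃ (X : ConstList C Λ) (f' : X.prod ⨯ A ⟶ B), f = graph X A ≫ (incl C Λ).map f' := by
  obtain ⟨X, f', rfl⟩ := exists_homMk f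
  exact ⟨X, f', (graph_comp_incl X f').symm⟩

/-- The tuple of the constants of a list. -/
noncomputable def tuple (X : ConstList C Λ) :
    (incl C Λ).obj (⊤_ C) ⟶ (incl C Λ).obj X.prod :=
  homMk X prod.fst

/-- Both sides name the same constants; the colimit identifies a projection taken at the stage `X`
with its pullback to the stage `Y`. -/
theorem tuple_restr {X Y : ConstList C Λ} (h : X ≤ Y) :
    tuple Y ≫ (incl C Λ).map (restr h) = tuple X := by
  refine (homMk_comp_incl Y _ _).trans ?_
  rw [← trans_fst]
  exact homMk_trans h _

/-- Together with `graph_snd` this exhibits the graph as a pairing of a tuple of constants with the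
identity, so that compatibility with tuples implies compatibility with graphs. -/
theorem graph_fst (X : ConstList C Λ) (A : C) :
    graph X A ≫ (incl C Λ).map prod.fst = (incl C Λ).map (terminal.from A) ≫ tuple X := by
  refine (graph_comp_incl X _).trans ?_
  rw [incl_map _ X]
  refine Eq.trans ?_ (homMk_comp X _ _).symm
  rw [prod.lift_fst]

theorem graph_snd (X : ConstList C Λ) (A : C) :
    graph X A ≫ (incl C Λ).map prod.snd = 𝟙 ((incl C Λ).obj A) :=
  (graph_comp_incl X _).trans (id_eq' X).symm

/-- The counterpart for fibers of the factorization of arrows: a formula with constants is a formula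
of `P` with the constants substituted for some variables. -/
theorem re_graph_unit {P : Cᵒᵖ ⥤ PartOrd.{u}} {A : C} (X : ConstList C Λ)
    (φ : Fib P (X.prod ⨯ A)) : re (doctrine P Λ) (graph X A) (unit.app _ φ) = fibMk X φ := by
  rw [unit_app' X]
  refine (re_fibMk X _ _).trans ?_
  rw [← re_comp, prod.lift_snd, re_id]

end Graph

/-! ### Morphisms from a doctrine with constants -/

section Desc

variable {C : Type u} [SmallCategory C] [HasFiniteProducts C]
  {D : Type u'} [Category.{v'} D]

/-- Compatible interpretations, for a functor from `C`, of the tuples of constants as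
global elements. -/
structure Interp (Λ : Type u) (K : C ⥤ D) where
  pt : D
  isTerminal : IsTerminal pt
  val : ∀ X : ConstList C Λ, pt ⟶ K.obj X.prod
  val_restr : ∀ {X Y : ConstList C Λ} (h : X ≤ Y), val Y ≫ K.map (restr h) = val X

theorem map_prod_hom_ext (K : C ⥤ D) [PreservesFiniteProducts K] {A B : C} {Z : D}
    {f g : Z ⟶ K.obj (A ⨯ B)} (h₁ : f ≫ K.map prod.fst = g ≫ K.map prod.fst)
    (h₂ : f ≫ K.map prod.snd = g ≫ K.map prod.snd) : f = g :=
  fan_hom_ext (mapIsLimitOfPreservesOfIsLimit K _ _ (prodFan A B)) h₁ h₂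

/-! ### Extension of a functor along an interpretation of the constants -/

namespace Interp

variable {Λ : Type u} {K : C ⥤ D} [PreservesFiniteProducts K] (c : Interp Λ K)

theorem exists_ins (X : ConstList C Λ) (A : C) : ∃ i : K.obj A ⟶ K.obj (X.prod ⨯ A),
    i ≫ K.map prod.fst = c.isTerminal.from (K.obj A) ≫ c.val X ∧
      i ≫ K.map prod.snd = 𝟙 (K.obj A) :=
  ⟨_, (BinaryFan.IsLimit.lift' (mapIsLimitOfPreservesOfIsLimit K _ _ (prodFan X.prod A))
    (c.isTerminal.from (K.obj A) ≫ c.val X) (𝟙 (K.obj A))).2⟩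

/-- Insertion of the values of the constants. -/
noncomputable def ins (X : ConstList C Λ) (A : C) : K.obj A ⟶ K.obj (X.prod ⨯ A) :=
  (c.exists_ins X A).choose

theorem ins_fst (X : ConstList C Λ) (A : C) :
    c.ins X A ≫ K.map prod.fst = c.isTerminal.from (K.obj A) ≫ c.val X :=
  (c.exists_ins X A).choose_spec.1

theorem ins_fst_assoc (X : ConstList C Λ) (A : C) {Z : D} (k : K.obj X.prod ⟶ Z) :
    c.ins X A ≫ K.map prod.fst ≫ k = c.isTerminal.from (K.obj A) ≫ c.val X ≫ k := by
  rw [← Category.assoc, ins_fst, Category.assoc]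

theorem ins_snd (X : ConstList C Λ) (A : C) : c.ins X A ≫ K.map prod.snd = 𝟙 (K.obj A) :=
  (c.exists_ins X A).choose_spec.2

theorem ins_snd_assoc (X : ConstList C Λ) (A : C) {Z : D} (k : K.obj A ⟶ Z) :
    c.ins X A ≫ K.map prod.snd ≫ k = k := by
  rw [← Category.assoc, ins_snd, Category.id_comp]

/-- This independence of the stage is what makes the extension well defined on the colimits of
arrows and of fibers. -/
theorem ins_trans {X Y : ConstList C Λ} (h : X ≤ Y) (A : C) :
    c.ins Y A ≫ K.map (trans h A) = c.ins X A := by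
  apply map_prod_hom_ext
  · rw [Category.assoc, ← K.map_comp, trans_fst, K.map_comp, ins_fst_assoc, ins_fst, c.val_restr]
  · rw [Category.assoc, ← K.map_comp, trans_snd, ins_snd, ins_snd]

/-- The constants do not depend on the variable, since they factor through a terminal object.
Inserting them after `f` or keeping the copy inserted before `f` is therefore the same; this yields
functoriality and the naturality of `descFib`. -/
theorem ins_comp_ins {A B : C} (X : ConstList C Λ) (f : X.prod ⨯ A ⟶ B) :
    (c.ins X A ≫ K.map f) ≫ c.ins X B = c.ins X A ≫ K.map (prod.lift prod.fst f) := by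
  apply map_prod_hom_ext
  · rw [Category.assoc, Category.assoc, ins_fst, ← Category.assoc, ← Category.assoc,
      c.isTerminal.comp_from, Category.assoc, ← K.map_comp, prod.lift_fst, ins_fst]
  · rw [Category.assoc, Category.assoc, ins_snd, Category.comp_id, Category.assoc, ← K.map_comp,
      prod.lift_snd]

/-- The action on arrows of the functor extending `K`. -/
noncomputable def mapHom {A B : C} : (homFam Λ A B).Colim → (K.obj A ⟶ K.obj B) :=
  Quotient.lift (s := (homFam Λ A B).rel) (fun f => c.ins f.1 A ≫ K.map f.2) (by
    rintro ⟨X, f⟩ ⟨Y, g⟩ ⟨Z, hX, hY, e⟩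
    dsimp only at e ⊢
    rw [← c.ins_trans hX, ← c.ins_trans hY, Category.assoc, Category.assoc, ← K.map_comp, e,
      K.map_comp])

/-- The functor from the category with constants which extends `K`. -/
noncomputable def functor : AddConst C Λ ⥤ D where
  obj A := K.obj A.obj
  map f := c.mapHom f
  map_id A := c.ins_snd nil A.obj
  map_comp f g := by
    obtain ⟨X, f, g, rfl, rfl⟩ := exists_homMk₂ f g
    refine (congrArg c.mapHom (homMk_comp X f g)).trans ?_
    change c.ins X _ ≫ K.map _ = (c.ins X _ ≫ K.map _) ≫ c.ins X _ ≫ K.map _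
    rw [K.map_comp, ← Category.assoc, ← ins_comp_ins, Category.assoc _ (c.ins X _)]

theorem functor_homMk {A B : C} (X : ConstList C Λ) (f : X.prod ⨯ A ⟶ B) :
    c.functor.map (homMk X f) = c.ins X A ≫ K.map f := rfl

theorem functor_incl {A B : C} (f : A ⟶ B) : c.functor.map ((incl C Λ).map f) = K.map f := by
  refine (c.functor_homMk nil _).trans ?_
  rw [K.map_comp, ins_snd_assoc]

/-- Terminal objects and product diagrams of `C` remain such in `AddConst C Λ`, and there the
extension agrees with `K`, so one limit cone of each shape suffices. -/
theorem functor_preserves : PreservesFiniteProducts c.functor := by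
  have h₁ : PreservesLimit (Functor.empty.{0} (AddConst C Λ)) c.functor :=
    preservesLimit_of_preserves_limit_cone (AddConst.isTerminal (terminalIsTerminal (C := C)))
      ((isLimitMapConeEmptyConeEquiv _ _).symm (IsTerminal.isTerminalObj K _ terminalIsTerminal))
  have h₂ : PreservesLimitsOfShape (Discrete PEmpty.{1}) c.functor :=
    preservesLimitsOfShape_pempty_of_preservesTerminal _
  have h₃ : PreservesLimitsOfShape (Discrete WalkingPair) c.functor := ⟨fun {L} => by
    have : PreservesLimit (pair (L.obj ⟨.left⟩) (L.obj ⟨.right⟩)) c.functor := by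
      refine preservesLimit_of_preserves_limit_cone
        (isLimitFan (prodFan (L.obj ⟨.left⟩).obj (L.obj ⟨.right⟩).obj))
        ((isLimitMapConeBinaryFanEquiv _ _ _).symm ?_)
      rw [functor_incl, functor_incl]
      exact mapIsLimitOfPreservesOfIsLimit K _ _ (prodFan _ _)
    exact preservesLimit_of_iso_diagram _ (diagramIsoPair L).symm⟩
  exact .of_preserves_binary_and_terminal _

end Interp

/-! ### Extension to the fibers and preservation of the logical structure -/

variable {P : Cᵒᵖ ⥤ PartOrd.{u}} {Λ : Type u} {R : Dᵒᵖ ⥤ PartOrd.{u}} {K : DoctrineHom P R}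
  [PreservesFiniteProducts K.functor] (c : Interp Λ K.functor)

/-- The action on the fibers of the morphism extending `K`. -/
noncomputable def descFib {A : C} : (fibFam P Λ A).Colim → Fib R (K.functor.obj A) :=
  Quotient.lift (s := (fibFam P Λ A).rel) (fun φ => re R (c.ins φ.1 A) (K.app _ φ.2)) (by
    rintro ⟨X, φ⟩ ⟨Y, ψ⟩ ⟨Z, hX, hY, e⟩
    dsimp only at e ⊢
    rw [← c.ins_trans hX, ← c.ins_trans hY, re_comp, re_comp, ← K.app_re, ← K.app_re, e])

theorem descFib_re {A B : AddConst C Λ} (f : A ⟶ B) (z : Fib (doctrine P Λ) B) :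
    descFib c (re (doctrine P Λ) f z) = re R (c.functor.map f) (descFib c z) := by
  obtain ⟨X, f, rfl⟩ := exists_homMk f
  obtain ⟨Y, φ, rfl⟩ := exists_fibMk z
  obtain ⟨Z, hX, hY⟩ := exists_ge_ge X Y
  rw [← homMk_trans hX, ← fibMk_trans hY]
  generalize trans hX A.obj ≫ f = f
  generalize re P (trans hY B.obj) φ = φ
  refine (congrArg (descFib c) (re_fibMk Z f φ)).trans ?_
  refine Eq.trans ?_ (congrArg (fun t => re R t _) (c.functor_homMk Z f).symm)
  change re R (c.ins Z _) (K.app _ _) = re R _ (re R (c.ins Z _) (K.app _ _))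
  rw [K.app_re, ← re_comp, ← re_comp, ← c.ins_comp_ins]

theorem descFib_mono {A : C} : Monotone (descFib c : (fibFam P Λ A).Colim → _) := by
  intro z w h
  obtain ⟨X, φ, rfl⟩ := exists_fibCls z
  obtain ⟨Y, ψ, rfl⟩ := exists_fibCls w
  obtain ⟨Z, hX, hY, h⟩ := fibCls_le.1 h
  rw [← fibCls_trans hX, ← fibCls_trans hY]
  exact (re R _).monotone ((K.app _).monotone h)

/-- The morphism from the doctrine with constants which extends `K`. -/
noncomputable def desc : DoctrineHom (doctrine P Λ) R where
  functor := c.functor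
  preserves := c.functor_preserves
  trans :=
    { app := fun A => PartOrd.ofHom ⟨fun z => descFib c z, descFib_mono c⟩
      naturality := fun A B f => by
        ext z
        exact descFib_re c f.unop z }

theorem desc_fibMk {A : C} (X : ConstList C Λ) (φ : Fib P (X.prod ⨯ A)) :
    (desc c).app ⟨A⟩ (fibMk X φ) = re R (c.ins X A) (K.app _ φ) := rfl

theorem desc_unit {A : C} (α : Fib P A) : (desc c).app ⟨A⟩ (unit.app A α) = K.app A α := by
  refine (desc_fibMk c nil _).trans ?_
  rw [K.app_re, ← re_comp, c.ins_snd, re_id]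

/-- Each logical operation can be computed at a single stage by uniqueness. There `K` preserves it,
and reindexing along `ins` in `R` preserves it again; for quantifiers the last step is the
Beck-Chevalley condition. -/
theorem desc_isImpEx [Implicational P] [Existential P] [HasFiniteProducts D] [Implicational R]
    [Existential R] (hK : K.IsImpEx) : (desc c).IsImpEx where
  top A t h := by
    obtain ⟨t₀, ht₀⟩ := Primary.exists_top (P := P) ((nil (C := C) (Λ := Λ)).prod ⨯ A.obj)
    rw [isTop_unique h (fibMk_isTop ht₀)]
    exact Primary.re_top _ _ (hK.top _ _ ht₀)
  meet A x y m h := by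
    obtain ⟨X, x, y, rfl, rfl⟩ := exists_fibMk₂ x y
    obtain ⟨m₀, hm₀⟩ := Primary.exists_meet (P := P) _ x y
    rw [h.unique (fibMk_isGLB hm₀)]
    exact Primary.re_meet _ _ _ _ (hK.meet _ _ _ _ hm₀)
  imp A x y k h := by
    obtain ⟨X, x, y, rfl, rfl⟩ := exists_fibMk₂ x y
    obtain ⟨k₀, hk₀⟩ := Implicational.exists_imp (P := P) _ x y
    rw [isImp_unique h (fibMk_isImp hk₀)]
    exact Implicational.re_imp _ _ _ _ (hK.imp _ _ _ _ hk₀)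
  ex A B φ e h := by
    -- The chosen product in `AddConst` need not be the one inherited from `C`, but only the latter
    -- has fibers that are computed stage by stage.
    refine (desc c).ex_of_fan (isLimitFan (prodFan A.obj B.obj)) (prodFan A B) ?_ h
    clear h φ e
    intro φ e h
    refine (congrArg (fun t => IsEx (re R t) _ _) (c.functor_incl prod.fst)).mpr ?_
    obtain ⟨X, φ, rfl⟩ := exists_fibMk' (A := A.obj ⨯ B.obj) φ
    obtain ⟨e₀, he₀⟩ := exists_stage_ex X φ
    rw [h.unique (fibMk_isEx he₀)]
    have l₁ := mapIsLimitOfPreservesOfIsLimit K.functor _ _ (stageFan X.prod A.obj B.obj)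
    have l₂ := mapIsLimitOfPreservesOfIsLimit K.functor _ _ (prodFan A.obj B.obj)
    -- The quantifier at the stage `X` keeps the constants as parameters; Beck-Chevalley along their
    -- insertion substitutes the values for these parameters.
    refine beckChevalley_fan l₁ l₂ (c.ins X A.obj) (c.ins X (A.obj ⨯ B.obj)) ?_ ?_
      (hK.ex_fan (stageFan X.prod A.obj B.obj) he₀)
    · apply map_prod_hom_ext
      · rw [Category.assoc, ← K.functor.map_comp, prod.lift_fst, c.ins_fst, Category.assoc,
          c.ins_fst, ← Category.assoc, c.isTerminal.comp_from]
      · rw [Category.assoc, ← K.functor.map_comp, prod.lift_snd, K.functor.map_comp,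
          c.ins_snd_assoc, Category.assoc, c.ins_snd, Category.comp_id]
    · rw [K.functor.map_comp, c.ins_snd_assoc]

end Desc

end AddConst

namespace AddAx

/-! ### Morphisms from a doctrine with axioms -/

variable {E : Type u} [Category.{v} E] {Q : Eᵒᵖ ⥤ PartOrd.{w}} [Primary Q]
  {T : E} (hT : IsTerminal T) {κ : Type w} (ψ : κ → Fib Q T)
  {D : Type u'} [Category.{v'} D] {R : Dᵒᵖ ⥤ PartOrd.{w}} [Primary R]

/-- At the stage of the single axiom `k`, every element is already below `ψ k`. -/
theorem qMk_axiom_isTop (k : κ) : IsTop (qMk hT ψ (ψ k)) := by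
  intro z
  obtain ⟨α, rfl⟩ := exists_qMk hT ψ z
  refine (qMk_le hT ψ).2 ⟨{k}, (meet_le_right _ _).trans ?_⟩
  rw [ax, hT.hom_ext (hT.from T) (𝟙 T), re_id]
  exact (conj_isGLB ψ {k}).1 ⟨k, by simp, rfl⟩

theorem isTop_of_isGLB {L : Type w} [PartialOrder L] {x y m : L} (h : IsGLB {x, y} m)
    (hx : IsTop x) (hy : IsTop y) : IsTop m := fun z =>
  (isGLB_pair_iff.1 h).2.2 z (hx z) (hy z)

variable (M : DoctrineHom Q R)

theorem app_ax_isTop [HasFiniteProducts E] (hM : M.IsImpEx)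
    (hψ : ∀ k, IsTop (M.app T (ψ k))) (U : Finset κ) (A : E) :
    IsTop (M.app A (ax hT ψ U A)) := by
  rw [ax, M.app_re]
  refine Primary.re_top _ _ ?_
  classical
  induction U using Finset.induction_on with
  | empty =>
    refine hM.top _ _ fun z => (conj_isGLB ψ ∅).2 ?_
    simp [lowerBounds]
  | insert i U _ ih =>
    -- `M` is known to preserve binary meets only, so the finite meet is split into one axiom and
    -- the meet of the others.
    have h : IsGLB {ψ i, conj ψ U} (conj ψ (insert i U)) := by
      have h₁ := conj_isGLB ψ (insert i U)
      have h₂ := conj_isGLB ψ U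
      rw [Finset.coe_insert, Set.image_insert_eq] at h₁
      refine isGLB_pair_iff.2 ⟨h₁.1 (Set.mem_insert _ _),
        h₂.2 fun y hy => h₁.1 (Set.mem_insert_of_mem _ hy), fun z hz hz' => h₁.2 ?_⟩
      rintro _ (rfl | hy)
      · exact hz
      · exact hz'.trans (h₂.1 hy)
    exact isTop_of_isGLB (hM.meet _ _ _ _ h) (hψ i) ih

/-- Once the axioms are sent to top, `M` does not see the transition maps between stages. Both the
definition of `descFib` on classes and the monotonicity in `desc` rest on this. -/
theorem app_meet_ax [HasFiniteProducts E] (hM : M.IsImpEx)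
    (hψ : ∀ k, IsTop (M.app T (ψ k))) (U : Finset κ) {A : E} (α : Fib Q A) :
    M.app A (meet α (ax hT ψ U A)) = M.app A α := by
  have h := isGLB_pair_iff.1 (hM.meet _ _ _ _ (meet_isGLB α (ax hT ψ U A)))
  exact le_antisymm h.1 (h.2.2 _ le_rfl (app_ax_isTop hT ψ M hM hψ U A _))

variable [HasFiniteProducts E] (hM : M.IsImpEx) (hψ : ∀ k, IsTop (M.app T (ψ k)))

/-- The action on the fibers of the morphism from the doctrine with axioms. -/
noncomputable def descFib {A : E} : (fam hT ψ A).Colim → Fib R (M.functor.obj A) :=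
  Quotient.lift (s := (fam hT ψ A).rel) (fun α => M.app A α.2.1) (by
    rintro ⟨U, α⟩ ⟨V, β⟩ ⟨W, hU, hV, e⟩
    have := congrArg (fun t => M.app A t.1) e
    change M.app A (meet _ _) = M.app A (meet _ _) at this
    rwa [app_meet_ax hT ψ M hM hψ, app_meet_ax hT ψ M hM hψ] at this)

/-- The factorization of a morphism which maps the axioms to top elements. -/
noncomputable def desc : DoctrineHom (doctrine hT ψ) R where
  functor := M.functor
  preserves := M.preserves
  trans :=
    { app := fun A => PartOrd.ofHom ⟨fun z => descFib hT ψ M hM hψ z, by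
        intro z w h
        obtain ⟨α, rfl⟩ := q_surjective hT ψ z
        obtain ⟨β, rfl⟩ := q_surjective hT ψ w
        obtain ⟨U, h⟩ := (q_le hT ψ).1 h
        exact (app_meet_ax hT ψ M hM hψ U α).symm.le.trans ((M.app _).monotone h)⟩
      naturality := fun A B f => by
        ext z
        obtain ⟨α, rfl⟩ := q_surjective hT ψ z
        exact M.app_re f.unop α }

theorem desc_isImpEx [Implicational Q] [Existential Q] : (desc hT ψ M hM hψ).IsImpEx where
  top A t h := by
    obtain ⟨t₀, ht₀⟩ := Primary.exists_top (P := Q) A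
    rw [isTop_unique h (qMk_isTop hT ψ ht₀)]
    exact hM.top _ _ ht₀
  meet A x y m h := by
    obtain ⟨x, rfl⟩ := exists_qMk hT ψ x
    obtain ⟨y, rfl⟩ := exists_qMk hT ψ y
    rw [h.unique (qMk_isGLB hT ψ (meet_isGLB x y))]
    exact hM.meet _ _ _ _ (meet_isGLB x y)
  imp A x y k h := by
    obtain ⟨x, rfl⟩ := exists_qMk hT ψ x
    obtain ⟨y, rfl⟩ := exists_qMk hT ψ y
    obtain ⟨k₀, hk₀⟩ := Implicational.exists_imp A x y
    rw [isImp_unique h (qMk_isImp hT ψ hk₀)]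
    exact hM.imp _ _ _ _ hk₀
  ex A B φ e h := by
    obtain ⟨φ, rfl⟩ := exists_qMk hT ψ φ
    obtain ⟨e₀, he₀⟩ := Existential.exists_ex A B φ
    rw [h.unique (qMk_isEx hT ψ he₀)]
    exact hM.ex _ _ _ _ he₀

end AddAx

namespace AddConst

open ConstList

/-! ### 2-cells between morphisms from a doctrine with constants -/

section TwoCells

variable {C : Type u} [SmallCategory C] [HasFiniteProducts C] {Λ : Type u}
  {D : Type u'} [Category.{v'} D]

theorem map_incl_prod_hom_ext (N : AddConst C Λ ⥤ D) [PreservesFiniteProducts N] {A B : C} {Z : D}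
    {f g : Z ⟶ N.obj ((incl C Λ).obj (A ⨯ B))}
    (h₁ : f ≫ N.map ((incl C Λ).map prod.fst) = g ≫ N.map ((incl C Λ).map prod.fst))
    (h₂ : f ≫ N.map ((incl C Λ).map prod.snd) = g ≫ N.map ((incl C Λ).map prod.snd)) : f = g :=
  fan_hom_ext (mapIsLimitOfPreservesOfIsLimit N _ _ (isLimitFan (prodFan A B))) h₁ h₂

variable {M N : AddConst C Λ ⥤ D} [PreservesFiniteProducts N]
  {ζ : ∀ A : C, M.obj ((incl C Λ).obj A) ⟶ N.obj ((incl C Λ).obj A)}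
  (hi : ∀ {A B : C} (f : A ⟶ B),
    M.map ((incl C Λ).map f) ≫ ζ B = ζ A ≫ N.map ((incl C Λ).map f))
  (hc : ∀ X : ConstList C Λ, M.map (tuple X) ≫ ζ X.prod = ζ (⊤_ C) ≫ N.map (tuple X))

-- Graphs land in a product that `N` preserves, so the square is checked on the two projections: the
-- first reduces to `hc` at the tuple, the second to an identity.
include hi hc in
theorem graph_naturality (X : ConstList C Λ) (A : C) :
    M.map (graph X A) ≫ ζ (X.prod ⨯ A) = ζ A ≫ N.map (graph X A) := by
  apply map_incl_prod_hom_ext N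
  · rw [Category.assoc, ← hi, ← Category.assoc, ← M.map_comp, graph_fst,
      Category.assoc, ← N.map_comp, graph_fst, M.map_comp, N.map_comp, Category.assoc, hc,
      ← Category.assoc, hi, Category.assoc]
  · rw [Category.assoc, ← hi, ← Category.assoc, ← M.map_comp, graph_snd,
      Category.assoc, ← N.map_comp, graph_snd, M.map_id, N.map_id, Category.id_comp,
      Category.comp_id]

include hi hc in
theorem naturality_of_incl {A B : C} (f : (incl C Λ).obj A ⟶ (incl C Λ).obj B) :
    M.map f ≫ ζ B = ζ A ≫ N.map f := by
  obtain ⟨X, f, rfl⟩ := exists_graph_comp_incl f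
  rw [M.map_comp, N.map_comp, Category.assoc, hi, ← Category.assoc,
    graph_naturality hi hc, Category.assoc]

/-- A family which is natural for the arrows of `C` and compatible with the constants is
natural for all arrows. -/
def extendNat : M ⟶ N where
  app A := ζ A.obj
  naturality _ _ f := naturality_of_incl hi hc f

/-- The inequality in the definition of 2-cells can be checked on the image of `P`. -/
theorem app_le_of_unit {P : Cᵒᵖ ⥤ PartOrd.{u}} {R : Dᵒᵖ ⥤ PartOrd.{u}}
    {M N : DoctrineHom (doctrine P Λ) R} (ζ : M.functor ⟶ N.functor)
    (h : ∀ (A : C) (α : Fib P A),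
      M.app _ (unit.app A α) ≤ re R (ζ.app _) (N.app _ (unit.app A α)))
    {A : C} (z : Fib (doctrine P Λ) ⟨A⟩) : M.app _ z ≤ re R (ζ.app _) (N.app _ z) := by
  obtain ⟨X, φ, rfl⟩ := exists_fibMk' z
  rw [← re_graph_unit X φ]
  have h₁ := M.app_re (graph X A) (unit.app _ φ)
  have h₂ := N.app_re (graph X A) (unit.app _ φ)
  -- Reindex the inequality for `φ` along the image under `M` of the graph; naturality of `ζ` at the
  -- graph then moves `ζ` to the outside.
  refine h₁.le.trans (((re R _).monotone (h _ φ)).trans (le_of_eq ?_))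
  refine Eq.trans ?_ (congrArg (re R (ζ.app ⟨A⟩)) h₂.symm)
  refine (re_comp R _ _ _).symm.trans (Eq.trans ?_ (re_comp R _ _ _))
  exact congrArg (fun t => re R t (N.app _ (unit.app _ φ))) (ζ.naturality (graph X A))

end TwoCells

end AddConst

namespace HenkinChoice

open ConstList AddConst

variable {C : Type u} [SmallCategory C] [HasFiniteProducts C] {P : Cᵒᵖ ⥤ PartOrd.{u}}
  [Implicational P] [Existential P] (𝓗 : HenkinChoice P)
  {D : Type u'} [Category.{v'} D] {R : Dᵒᵖ ⥤ PartOrd.{u}}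

/-! ### Extension of 2-cells -/

section Full

variable {𝓗} {G M N : DoctrineHom 𝓗.doctrine R}

/-- Every element is represented at the stage of no axioms, which reduces the claim to the doctrine
with constants. -/
theorem app_le_of_unit (ζ : M.functor ⟶ N.functor)
    (h : ∀ (A : C) (α : Fib P A),
      M.app _ (𝓗.unit.app A α) ≤ re R (ζ.app _) (N.app _ (𝓗.unit.app A α)))
    (A : AddConst C (Labels P)) (z : Fib 𝓗.doctrine A) :
    M.app A z ≤ re R (ζ.app A) (N.app A z) := by
  obtain ⟨α, rfl⟩ := AddAx.exists_qMk _ _ z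
  exact AddConst.app_le_of_unit (M := (AddAx.unit _ 𝓗.henkinAx).comp M)
    (N := (AddAx.unit _ 𝓗.henkinAx).comp N) ζ h α

/-- The images of the terminal object of `C` are terminal. -/
noncomputable def isTerminalObj (M : DoctrineHom 𝓗.doctrine R) :
    IsTerminal (M.functor.obj ((incl C (Labels P)).obj (⊤_ C))) :=
  have := M.preserves
  IsTerminal.isTerminalObj M.functor _ (AddConst.isTerminal terminalIsTerminal)

/-- Fullness on coslices: the components of `ζ` already exist at every object, and only their
naturality at the constants has to be derived, from the triangle over `G`. -/
theorem exists_extension (θ : G ⟶ M) (θ' : G ⟶ N)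
    (ζ : (𝓗.unit.precomp R).obj M ⟶ (𝓗.unit.precomp R).obj N)
    (h : (𝓗.unit.precomp R).map θ ≫ ζ = (𝓗.unit.precomp R).map θ') :
    ∃ ξ : M ⟶ N, (𝓗.unit.precomp R).map ξ = ζ ∧ θ ≫ ξ = θ' := by
  have := N.preserves
  let t (A : C) : G.functor.obj ((incl C (Labels P)).obj A) ⟶
      M.functor.obj ((incl C (Labels P)).obj A) := (DoctrineHom.TwoCell.nat θ).app _
  let t' (A : C) : G.functor.obj ((incl C (Labels P)).obj A) ⟶
      N.functor.obj ((incl C (Labels P)).obj A) := (DoctrineHom.TwoCell.nat θ').app _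
  let z (A : C) : M.functor.obj ((incl C (Labels P)).obj A) ⟶
      N.functor.obj ((incl C (Labels P)).obj A) := (DoctrineHom.TwoCell.nat ζ).app A
  have h' : ∀ A : C, t A ≫ z A = t' A := fun A =>
    congrArg (fun t => (DoctrineHom.TwoCell.nat t).app A) h
  have hi : ∀ {A B : C} (f : A ⟶ B), M.functor.map ((incl C (Labels P)).map f) ≫ z B =
      z A ≫ N.functor.map ((incl C (Labels P)).map f) := fun f =>
    (DoctrineHom.TwoCell.nat ζ).naturality f
  have hc : ∀ X : ConstList C (Labels P),
      M.functor.map (tuple X) ≫ z X.prod = z (⊤_ C) ≫ N.functor.map (tuple X) := by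
    intro X
    -- Invertibility at the terminal object allows the square for `z` to be tested after
    -- precomposition with `t`, where it becomes the square for `t'`.
    have : IsIso (t (⊤_ C)) := isIso_of_isTerminal (isTerminalObj G) (isTerminalObj M) _
    have e₁ : G.functor.map (tuple X) ≫ t X.prod = t (⊤_ C) ≫ M.functor.map (tuple X) :=
      (DoctrineHom.TwoCell.nat θ).naturality (tuple X)
    have e₂ : G.functor.map (tuple X) ≫ t' X.prod = t' (⊤_ C) ≫ N.functor.map (tuple X) :=
      (DoctrineHom.TwoCell.nat θ').naturality (tuple X)
    rw [← cancel_epi (t (⊤_ C)), ← Category.assoc, ← e₁, Category.assoc, h', e₂, ← h',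
      Category.assoc]
  let ξ : M ⟶ N := ⟨extendNat hi hc,
    HenkinChoice.app_le_of_unit _ fun A α => DoctrineHom.TwoCell.le ζ A α⟩
  refine ⟨ξ, rfl, ?_⟩
  apply DoctrineHom.TwoCell.ext
  ext A
  exact h' A.obj

end Full

/-! ### Extension of 1-arrows -/

section EssSurj

variable {𝓗} {G : DoctrineHom 𝓗.doctrine R} {K : DoctrineHom P R} (θ : 𝓗.unit.comp G ⟶ K)

/-- The components of a 2-cell, as arrows from the images of the objects of `C`. -/
def component (A : C) : G.functor.obj ((incl C (Labels P)).obj A) ⟶ K.functor.obj A :=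
  (DoctrineHom.TwoCell.nat θ).app A

theorem component_naturality {A B : C} (f : A ⟶ B) :
    G.functor.map ((incl C (Labels P)).map f) ≫ component θ B =
      component θ A ≫ K.functor.map f :=
  (DoctrineHom.TwoCell.nat θ).naturality f

/-- The constants are interpreted through `G` and `θ`. -/
noncomputable def interp : Interp (Labels P) K.functor where
  -- With the image under `G` as terminal object, the values need no inverse of the component of `θ`
  -- at the terminal object.
  pt := G.functor.obj ((incl C (Labels P)).obj (⊤_ C))
  isTerminal := isTerminalObj G
  val X := G.functor.map (tuple X) ≫ component θ X.prod
  val_restr h := by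
    rw [Category.assoc, ← component_naturality, ← Category.assoc, ← G.functor.map_comp,
      tuple_restr]

variable [PreservesFiniteProducts K.functor]

/-- The transformation from `G` to the extension of `K`. -/
noncomputable def extNat : G.functor ⟶ (interp θ).functor :=
  have := (interp θ).functor_preserves
  extendNat (ζ := component θ)
    (fun {A B} f => (component_naturality θ f).trans
      (congrArg (component θ A ≫ ·) ((interp θ).functor_incl f).symm))
    fun X => by
      -- The component goes from `pt` to the image under `K`, and returning to `pt` must give the
      -- identity. The extension thus takes a tuple to its prescribed value, up to this
      -- identification.
      have e : component θ (⊤_ C) ≫ (interp θ).isTerminal.from _ = 𝟙 _ :=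
        (interp θ).isTerminal.hom_ext _ _
      change (interp θ).val X = component θ (⊤_ C) ≫ (interp θ).ins X _ ≫ K.functor.map prod.fst
      rw [Interp.ins_fst, ← Category.assoc, e]
      exact (Category.id_comp _).symm

theorem app_le_desc (A : AddConst C (Labels P))
    (z : Fib (AddConst.doctrine P (Labels P)) A) :
    ((AddAx.unit _ 𝓗.henkinAx).comp G).app A z ≤
      re R ((extNat θ).app A) ((AddConst.desc (interp θ)).app A z) := by
  refine AddConst.app_le_of_unit (M := (AddAx.unit _ 𝓗.henkinAx).comp G)
    (N := AddConst.desc (interp θ)) (extNat θ) (fun A α => ?_) z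
  refine (DoctrineHom.TwoCell.le θ A α).trans (le_of_eq ?_)
  exact congrArg (re R (component θ A)) (desc_unit (interp θ) α).symm

/-- The axiom holds in the source of `G`, so it is top under `G`. The 2-cell bounds that top element
by the reindexing, along an invertible arrow, of the image of the axiom in the extension, which must
then be top too. -/
theorem desc_henkinAx_isTop (hG : G.IsImpEx) (p : C × Labels P) :
    IsTop ((AddConst.desc (interp θ)).app _ (𝓗.henkinAx p)) := by
  have ht := hG.top _ _ (AddAx.qMk_axiom_isTop (AddConst.isTerminal terminalIsTerminal)
    𝓗.henkinAx p)
  have hK : IsTerminal (K.functor.obj (⊤_ C)) := IsTerminal.isTerminalObj _ _ terminalIsTerminal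
  have hi : IsIso (component θ (⊤_ C)) := isIso_of_isTerminal (isTerminalObj G) hK _
  -- The same element, with its fiber written through `K` so that reindexing along the inverse
  -- component applies.
  let y : Fib R (K.functor.obj (⊤_ C)) := (AddConst.desc (interp θ)).app _ (𝓗.henkinAx p)
  suffices IsTop y from this
  intro x
  have h : re R (component θ (⊤_ C)) x ≤ re R (component θ (⊤_ C)) y :=
    (ht (re R (component θ (⊤_ C)) x)).trans (app_le_desc θ _ (𝓗.henkinAx p))
  have h' := (re R (inv (component θ (⊤_ C)))).monotone h
  rwa [← re_comp, ← re_comp, IsIso.inv_hom_id, re_id, re_id] at h'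

variable [HasFiniteProducts D] [Implicational R] [Existential R] (hG : G.IsImpEx) (hK : K.IsImpEx)

/-- The extension of `K` to the doctrine with Henkin constants and axioms. -/
noncomputable def extension : DoctrineHom 𝓗.doctrine R :=
  AddAx.desc _ 𝓗.henkinAx (AddConst.desc (interp θ)) (desc_isImpEx _ hK)
    (desc_henkinAx_isTop θ hG)

theorem extension_isImpEx : (extension θ hG hK).IsImpEx :=
  AddAx.desc_isImpEx _ _ _ _ _

/-- The 2-cell to the extension. -/
noncomputable def toExtension : G ⟶ extension θ hG hK :=
  ⟨extNat θ, fun A z => by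
    obtain ⟨α, rfl⟩ := AddAx.exists_qMk _ _ z
    exact app_le_desc θ A α⟩

/-- An equality in the fibers, so the identity components of `extensionIso` satisfy the 2-cell
inequality in both directions. -/
theorem extension_app {A : C} (α : Fib P A) :
    (𝓗.unit.comp (extension θ hG hK)).app A α = K.app A α :=
  desc_unit (interp θ) α

/-- The extension restricts to `K`. -/
noncomputable def extensionIso : 𝓗.unit.comp (extension θ hG hK) ≅ K where
  hom := ⟨{ app := fun A => 𝟙 (K.functor.obj A)
            naturality := fun A B f => (Category.comp_id _).trans
              (((interp θ).functor_incl f).trans (Category.id_comp _).symm) }, fun A α => by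
    exact (extension_app θ hG hK α).le.trans (re_id R _).ge⟩
  inv := ⟨{ app := fun A => 𝟙 (K.functor.obj A)
            naturality := fun A B f => (Category.comp_id _).trans
              (((interp θ).functor_incl f).symm.trans (Category.id_comp _).symm) }, fun A α => by
    refine (extension_app θ hG hK α).symm.le.trans (le_of_eq ?_)
    exact (re_id R _).symm⟩
  hom_inv_id := by
    apply DoctrineHom.TwoCell.ext
    ext A
    exact Category.comp_id _
  inv_hom_id := by
    apply DoctrineHom.TwoCell.ext
    ext A
    exact Category.comp_id _

theorem toExtension_comp :
    (𝓗.unit.precomp R).map (toExtension θ hG hK) ≫ (extensionIso θ hG hK).hom = θ := by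
  apply DoctrineHom.TwoCell.ext
  ext A
  exact Category.comp_id _

end EssSurj

/-! ### The equivalence of coslice categories -/

variable [HasFiniteProducts D]

/-- No object is added to the base, so whiskering loses no component of a 2-cell. -/
instance precomp_faithful : (𝓗.hom.precomp R).Faithful where
  map_injective {M N ζ ξ} h := by
    apply ObjectProperty.hom_ext
    apply DoctrineHom.TwoCell.ext
    ext A
    exact congrArg (fun t => (DoctrineHom.TwoCell.nat t.hom).app A.obj) h

instance post_full (G : ImpExHom 𝓗.doctrine R) :
    (Under.post (X := G) (𝓗.hom.precomp R)).Full where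
  map_surjective {M N} ζ := by
    obtain ⟨ξ, h, h'⟩ := exists_extension M.hom.hom N.hom.hom ζ.right.hom
      (congrArg (fun t => t.hom) (Under.w ζ))
    refine ⟨Under.homMk (ObjectProperty.homMk ξ) (ObjectProperty.hom_ext _ h'), ?_⟩
    apply Under.UnderMorphism.ext
    exact ObjectProperty.hom_ext _ h

instance post_essSurj [Implicational R] [Existential R] (G : ImpExHom 𝓗.doctrine R) :
    (Under.post (X := G) (𝓗.hom.precomp R)).EssSurj where
  mem_essImage K := by
    have := K.right.obj.preserves
    let θ : 𝓗.unit.comp G.obj ⟶ K.right.obj := K.hom.hom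
    refine ⟨Under.mk (Y := (⟨extension θ G.property K.right.property,
      extension_isImpEx _ _ _⟩ : ImpExHom 𝓗.doctrine R))
      (ObjectProperty.homMk (toExtension θ G.property K.right.property)), ⟨Under.isoMk
      (ObjectProperty.isoMk _ (extensionIso θ G.property K.right.property)) ?_⟩⟩
    exact ObjectProperty.hom_ext _ (toExtension_comp θ G.property K.right.property)

theorem coslice_isEquivalence [Implicational R] [Existential R] (H : ImpExHom P R)
    (G : ImpExHom 𝓗.doctrine R) (hG : (𝓗.hom.precomp R).obj G = H) :
    (𝓗.hom.coslice G H hG).IsEquivalence := by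
  -- The three fields are found by instance search: fullness and essential surjectivity from above,
  -- faithfulness from that of precomposition. The remaining factor `Under.map` is taken along an
  -- isomorphism, hence is an equivalence.
  have : (Under.post (X := G) (𝓗.hom.precomp R)).IsEquivalence := { }
  unfold ImpExHom.coslice
  infer_instance

end HenkinChoice

end HenkinDct

/-! ### The equivalence of coslices -/

theorem mainTheorem9 {C : Type u} [SmallCategory C] [HasFiniteProducts C]
    (P : Cᵒᵖ ⥤ PartOrd.{u}) [Implicational P] [Existential P] (𝓗 : HenkinChoice P)
    {D : Type u'} [Category.{v'} D] [HasFiniteProducts D]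
    (R : Dᵒᵖ ⥤ PartOrd.{u}) [Implicational R] [Existential R] (hR : IsRich R)
    (H : ImpExHom P R) (G : ImpExHom 𝓗.doctrine R) (hG : (𝓗.hom.precomp R).obj G = H) :
    (𝓗.hom.coslice G H hG).IsEquivalence ∧ (𝓗.hom.coslice G H hG).Faithful ∧
      (𝓗.hom.coslice G H hG).Full ∧ (𝓗.hom.coslice G H hG).EssSurj := by
  have := 𝓗.coslice_isEquivalence H G hG
  exact ⟨this, inferInstance, inferInstance, inferInstance⟩
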